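/- Consider a GI/GI/1/1 system: packets arrive at a single server without queue; an arrival finding the server busy is discarded, any other arrival is served at once (an arrival at the very instant of a departure is accepted). The inter-arrival times are i.i.d., the service times are i.i.d., both are non-negative with finite positive means, and the two sequences are independent of each other. The system is observed on $[0,\infty)$; its state at time $0$ (arrival times of the last two accepted packets before time $0$, the later of which may still be in service, its departure time, and the time of the first arrival after $0$) has an arbitrary law, independent of the later inter-arrival times and of the service times of the packets accepted later. Number by $k=0,1,2,\dots$ the packets accepted after time $0$; let $T_A(k)$, $X_k$, $T_D(k)=T_A(k)+X_k$ be the arrival time, service time and departure time of packet $k$. For $k\ge1$ let $I_k=T_A(k)-T_D(k-1)$ be the idle time just before the service of packet $k$, and let $\check Z_k$ be the time between the arrival of packet $k$ and the arrival (discarded or not) immediately before it. The age of information (AoI) $\Delta(t)$ is $t$ minus the latest arrival time of a packet that has departed by time $t$ (packets accepted before time $0$ included). Let $d>0$, let $k\ge1$, write $(x)^+=\max(0,x)$ and put $$\gamma^*(k)=\min\{(X_k+X_{k-1}+I_k-d)^+,\;X_k+I_k\},\qquad \Gamma_1(k)=\min\{(X_{k-1}+\check Z_k+X_k-d)^+,\;X_k+\check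 Z_k\}.$$ Then $X_k$, $I_k$, $\gamma^*(k)$ and $\Gamma_1(k)$ are integrable and $\mathbb E[X_k]+\mathbb E[I_k]>0$. Put $\nu=1/(\mathbb E[X_k]+\mathbb E[I_k])$. If the process $(\Delta(t))_{t\ge0}$ is stationary, then the violation probability $\mathbb P(\Delta>d)=\lim_{t\to\infty}\mathbb P(\Delta(t)>d)$ exists, and for every real $\hat\nu\ge\nu$ $$\mathbb P(\Delta>d)=\nu\,\mathbb E[\gamma^*(k)]\;\le\;\Phi_1=\hat\nu\,\mathbb E[\Gamma_1(k)].$$ -/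

import Mathlib

open MeasureTheory ProbabilityTheory Filter Topology

noncomputable section

/-- Random data driving a single-server system without queue, observed on `[0, ∞)`.
Arrivals after time `0` are numbered `0, 1, 2, …`; those which find the server busy are discarded.
The packets accepted from among them are numbered `k = 0, 1, 2, …`. -/
structure GG11 (Ω : Type*) where
  /-- `Z n` is the time between arrival `n` and arrival `n + 1`. -/
  Z : ℕ → Ω → ℝ
  /-- `X k` is the service time of the accepted packet `k`. -/
  X : ℕ → Ω → ℝ
  /-- Time (after `0`) of arrival `0`. -/
  F : Ω → ℝ
  /-- Arrival time of the last packet accepted before time `0` (call it the initial packet). -/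
  A : Ω → ℝ
  /-- Departure time of the initial packet; if it is positive, the server is busy at time `0`. -/
  D : Ω → ℝ
  /-- Arrival time of the packet delivered just before the initial packet. -/
  U : Ω → ℝ

namespace GG11

variable {Ω : Type*}

/-- Time of arrival `n`, counting discarded arrivals too. -/
def S (q : GG11 Ω) (n : ℕ) (ω : Ω) : ℝ := q.F ω + ∑ i ∈ Finset.range n, q.Z i ω

/-- `N k` is the number, among all arrivals, of the accepted packet `k`: the first arrival after
the preceding accepted packet which does not come before the departure of that packet. -/
def N (q : GG11 Ω) : ℕ → Ω → ℕ
  | 0, ω => sInf {n | q.D ω ≤ q.S n ω}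
  | k + 1, ω => sInf {n | N q k ω < n ∧ q.S (N q k ω) ω + q.X k ω ≤ q.S n ω}

/-- Arrival time of packet `k`. -/
def TA (q : GG11 Ω) (k : ℕ) (ω : Ω) : ℝ := q.S (q.N k ω) ω

/-- Departure time of packet `k`, which is served on arrival. -/
def TD (q : GG11 Ω) (k : ℕ) (ω : Ω) : ℝ := q.TA k ω + q.X k ω

/-- Age of information at time `t ≥ 0`: `t` minus the latest arrival time among the packets which
have departed by time `t`. -/
def aoi (q : GG11 Ω) (t : ℝ) (ω : Ω) : ℝ :=
  t - sSup ({q.U ω} ∪ {a | a = q.A ω ∧ q.D ω ≤ t} ∪ {a | ∃ k, a = q.TA k ω ∧ q.TD k ω ≤ t})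

/-- Idle time `I_k` just before the service of packet `k` (`1 ≤ k`). -/
def idle (q : GG11 Ω) (k : ℕ) (ω : Ω) : ℝ := q.TA k ω - q.TD (k - 1) ω

/-- Inter-arrival time `Ž_k` between packet `k` (`1 ≤ k`) and the arrival preceding it,
discarded or not. -/
def Zcheck (q : GG11 Ω) (k : ℕ) (ω : Ω) : ℝ := q.S (q.N k ω) ω - q.S (q.N k ω - 1) ω

/-- `γ*(k)` for age limit `d` (`1 ≤ k`). -/
def gammaStar (q : GG11 Ω) (d : ℝ) (k : ℕ) (ω : Ω) : ℝ :=
  min (max 0 (q.X k ω + q.X (k - 1) ω + q.idle k ω - d)) (q.X k ω + q.idle k ω)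

/-- `Γ₁(k)` for age limit `d` (`1 ≤ k`). -/
def Gamma1 (q : GG11 Ω) (d : ℝ) (k : ℕ) (ω : Ω) : ℝ :=
  min (max 0 (q.X (k - 1) ω + q.Zcheck k ω + q.X k ω - d)) (q.X k ω + q.Zcheck k ω)

/-- The GI/GI/1/1 assumptions: i.i.d. inter-arrival times, i.i.d. service times, with finite
positive means, the two sequences being independent of each other. The state of the system at
time `0` has an arbitrary law, independent of the two sequences. -/
structure IsGIGI11 [MeasurableSpace Ω] (P : Measure Ω) (q : GG11 Ω) : Prop where
  measurable_Z : ∀ n, Measurable (q.Z n)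
  measurable_X : ∀ k, Measurable (q.X k)
  measurable_F : Measurable q.F
  measurable_A : Measurable q.A
  measurable_D : Measurable q.D
  measurable_U : Measurable q.U
  Z_nonneg : ∀ n, ∀ᵐ ω ∂P, 0 ≤ q.Z n ω
  X_nonneg : ∀ k, ∀ᵐ ω ∂P, 0 ≤ q.X k ω
  Z_indep : iIndepFun q.Z P
  Z_ident : ∀ n, IdentDistrib (q.Z n) (q.Z 0) P P
  X_indep : iIndepFun q.X P
  X_ident : ∀ k, IdentDistrib (q.X k) (q.X 0) P P
  Z_integrable : Integrable (q.Z 0) P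
  Z_mean_pos : 0 < ∫ ω, q.Z 0 ω ∂P
  X_integrable : Integrable (q.X 0) P
  X_mean_pos : 0 < ∫ ω, q.X 0 ω ∂P
  ZX_indep : IndepFun (fun ω n => q.Z n ω) (fun ω k => q.X k ω) P
  init_indep : IndepFun (fun ω => (q.F ω, q.A ω, q.D ω, q.U ω))
    (fun ω => ((fun n => q.Z n ω), (fun k => q.X k ω))) P
  init_order : ∀ᵐ ω ∂P, q.U ω ≤ q.A ω ∧ q.A ω ≤ 0 ∧ q.A ω ≤ q.D ω ∧ 0 ≤ q.F ω

/-- Expected departure rate `ν = 1 / (E[X_k] + E[I_k])` (`1 ≤ k`). -/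
def nu [MeasurableSpace Ω] (P : Measure Ω) (q : GG11 Ω) (k : ℕ) : ℝ :=
  1 / (∫ ω, q.X k ω ∂P + ∫ ω, q.idle k ω ∂P)

end GG11

/-- (Strict) stationarity of a real process on `[0, ∞)`: its finite-dimensional distributions are
invariant under time shifts. -/
def IsStationaryProcess {Ω : Type*} [MeasurableSpace Ω] (P : Measure Ω) (Y : ℝ → Ω → ℝ) : Prop :=
  ∀ (n : ℕ) (t : Fin n → ℝ), (∀ i, 0 ≤ t i) → ∀ s : ℝ, 0 ≤ s →
    IdentDistrib (fun ω i => Y (t i + s) ω) (fun ω i => Y (t i) ω) P P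

end

/-! The pairs (service time, following idle time) are i.i.d.: at the arrival of an accepted packet
the pending inter-arrival and service times are fresh, by the strong Markov property at the first
arrival after a departure. Between the departures of packets `k` and `k + 1` the age is `t` minus
the arrival time of packet `k`, so it exceeds `d` during exactly `γ*(k + 1)` units of time, a
function of two consecutive cycles. Splitting into even and odd indices, the strong law of large
numbers gives that the long-run fraction of time with age above `d` is almost surely `ν E[γ*]`. By
Fubini and dominated convergence this is also the Cesàro limit of `P(Δ(t) > d)`, hence its limit as
soon as it has one. The bound follows from `I ≤ Ž`, and `Ž` is integrable by Wald's identity: the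
expected number of arrivals up to the first one past a service time is finite. -/

section Averages

variable {E : Type*} [NormedAddCommGroup E] [NormedSpace ℝ E]

theorem tendsto_inv_smul_comp {ι : Type*} {l : Filter ι} {a : ℕ → E} {x : E} {m : ι → ℕ}
    {r : ι → ℝ} {c : ℝ} (ha : Tendsto (fun n : ℕ => (n : ℝ)⁻¹ • a n) atTop (𝓝 x))
    (hm : Tendsto m l atTop) (hmr : Tendsto (fun i => (m i : ℝ) / r i) l (𝓝 c)) :
    Tendsto (fun i => (r i)⁻¹ • a (m i)) l (𝓝 (c • x)) := by
  refine (hmr.smul (ha.comp hm)).congr' ?_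
  filter_upwards [hm.eventually_gt_atTop 0] with i hi
  have hmi : (m i : ℝ) ≠ 0 := by exact_mod_cast hi.ne'
  rw [Function.comp_apply, smul_smul, div_mul_eq_mul_div, mul_inv_cancel₀ hmi, one_div]

theorem sum_range_eq_add_even_odd {M : Type*} [AddCommMonoid M] (a : ℕ → M) (n : ℕ) :
    ∑ j ∈ Finset.range n, a j =
      ∑ j ∈ Finset.range (n - n / 2), a (2 * j) + ∑ j ∈ Finset.range (n / 2), a (2 * j + 1) := by
  induction n with
  | zero => simp
  | succ n ih =>
    obtain ⟨m, rfl | rfl⟩ := Nat.even_or_odd' n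
    · rw [Finset.sum_range_succ, ih, show 2 * m + 1 - (2 * m + 1) / 2 = m + 1 by omega,
        show (2 * m + 1) / 2 = m by omega, show 2 * m / 2 = m by omega,
        show 2 * m - m = m by omega, Finset.sum_range_succ, add_right_comm]
    · rw [Finset.sum_range_succ, ih, show 2 * m + 1 + 1 - (2 * m + 1 + 1) / 2 = m + 1 by omega,
        show (2 * m + 1 + 1) / 2 = m + 1 by omega,
        show 2 * m + 1 - (2 * m + 1) / 2 = m + 1 by omega,
        show (2 * m + 1) / 2 = m by omega, Finset.sum_range_succ _ m,
        Finset.sum_range_succ (fun j => a (2 * j + 1)), add_assoc]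

theorem tendsto_average_of_even_odd {a : ℕ → E} {x : E}
    (heven : Tendsto (fun n : ℕ => (n : ℝ)⁻¹ • ∑ j ∈ Finset.range n, a (2 * j)) atTop (𝓝 x))
    (hodd : Tendsto (fun n : ℕ => (n : ℝ)⁻¹ • ∑ j ∈ Finset.range n, a (2 * j + 1)) atTop (𝓝 x)) :
    Tendsto (fun n : ℕ => (n : ℝ)⁻¹ • ∑ j ∈ Finset.range n, a j) atTop (𝓝 x) := by
  have hhalf : Tendsto (fun n : ℕ => ((n / 2 : ℕ) : ℝ) / n) atTop (𝓝 2⁻¹) :=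
    ((tendsto_nat_floor_mul_div_atTop (R := ℝ) (a := 2⁻¹) (by positivity)).comp
      tendsto_natCast_atTop_atTop).congr fun n => by
        rw [Function.comp_apply, inv_mul_eq_div, Nat.floor_div_ofNat, Nat.floor_natCast]
  have hhalf' : Tendsto (fun n : ℕ => ((n - n / 2 : ℕ) : ℝ) / n) atTop (𝓝 2⁻¹) := by
    rw [show (2⁻¹ : ℝ) = 1 - 2⁻¹ by norm_num]
    refine (tendsto_const_nhds.sub hhalf).congr' ?_
    filter_upwards [eventually_ne_atTop 0] with n hn
    rw [Nat.cast_sub (Nat.div_le_self n 2), sub_div, div_self (by exact_mod_cast hn)]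
  have hatTop : Tendsto (fun n : ℕ => n / 2) atTop atTop := Nat.tendsto_div_const_atTop two_ne_zero
  have hatTop' : Tendsto (fun n : ℕ => n - n / 2) atTop atTop :=
    tendsto_atTop_mono (fun n => by omega) hatTop
  have hsum := (tendsto_inv_smul_comp heven hatTop' hhalf').add
    (tendsto_inv_smul_comp hodd hatTop hhalf)
  rw [← add_smul, show (2⁻¹ + 2⁻¹ : ℝ) = 1 by norm_num, one_smul] at hsum
  exact hsum.congr fun n => by rw [sum_range_eq_add_even_odd a n, smul_add]

theorem tendsto_inv_smul_of_lipschitzWith {K : NNReal} {v : ℝ → E} (hv : LipschitzWith K v)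
    {s : ℕ → ℝ} {c : ℝ} {x : E} (hc : 0 < c) (hs : Tendsto (fun n : ℕ => s n / n) atTop (𝓝 c))
    (hvs : Tendsto (fun n : ℕ => (n : ℝ)⁻¹ • v (s n)) atTop (𝓝 x)) :
    Tendsto (fun t : ℝ => t⁻¹ • v t) atTop (𝓝 (c⁻¹ • x)) := by
  have hfloor : Tendsto (fun t : ℝ => (⌊c⁻¹ * t⌋₊ : ℝ) / t) atTop (𝓝 c⁻¹) :=
    tendsto_nat_floor_mul_div_atTop (inv_nonneg.2 hc.le)
  have hatTop : Tendsto (fun t : ℝ => ⌊c⁻¹ * t⌋₊) atTop atTop :=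
    tendsto_nat_floor_atTop.comp (tendsto_id.const_mul_atTop (inv_pos.2 hc))
  have hlim := tendsto_inv_smul_comp hvs hatTop hfloor
  have hs' : Tendsto (fun t : ℝ => t⁻¹ * s ⌊c⁻¹ * t⌋₊) atTop (𝓝 1) := by
    have h := tendsto_inv_smul_comp (a := s) (x := c)
      (hs.congr fun n => by rw [smul_eq_mul, inv_mul_eq_div]) hatTop hfloor
    rwa [smul_eq_mul, inv_mul_cancel₀ hc.ne'] at h
  have herr : Tendsto (fun t : ℝ => t⁻¹ • v t - t⁻¹ • v (s ⌊c⁻¹ * t⌋₊)) atTop (𝓝 0) := by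
    have h0 : Tendsto (fun t : ℝ => K * |1 - t⁻¹ * s ⌊c⁻¹ * t⌋₊|) atTop (𝓝 0) := by
      simpa using ((tendsto_const_nhds (x := (1 : ℝ))).sub hs').abs.const_mul (K : ℝ)
    refine squeeze_zero_norm' ?_ h0
    filter_upwards [eventually_gt_atTop 0] with t ht
    calc ‖t⁻¹ • v t - t⁻¹ • v (s ⌊c⁻¹ * t⌋₊)‖
        = t⁻¹ * ‖v t - v (s ⌊c⁻¹ * t⌋₊)‖ := by
          rw [← smul_sub, norm_smul, Real.norm_of_nonneg (inv_nonneg.2 ht.le)]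
      _ ≤ t⁻¹ * (K * |t - s ⌊c⁻¹ * t⌋₊|) := by
          gcongr
          exact hv.norm_sub_le _ _
      _ = K * |1 - t⁻¹ * s ⌊c⁻¹ * t⌋₊| := by
          rw [← inv_mul_cancel₀ ht.ne', ← mul_sub, abs_mul, abs_of_pos (inv_pos.2 ht)]
          ring
  simpa using hlim.add herr

theorem lipschitzWith_intervalIntegral {C : NNReal} {u : ℝ → E} (hu : AEStronglyMeasurable u)
    (hC : ∀ t, ‖u t‖ ≤ C) (a : ℝ) : LipschitzWith C fun b => ∫ t in a..b, u t := by
  have hint : ∀ b, IntervalIntegrable u volume a b := fun b =>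
    (intervalIntegrable_const (c := (C : ℝ))).mono_fun hu.restrict
      (ae_of_all _ fun t => by simpa using hC t)
  refine LipschitzWith.of_dist_le_mul fun b c => ?_
  rw [dist_eq_norm, intervalIntegral.integral_interval_sub_left (hint b) (hint c), Real.dist_eq]
  exact intervalIntegral.norm_integral_le_of_norm_le_const fun t _ => hC t

theorem tendsto_inv_smul_intervalIntegral_of_tendsto [CompleteSpace E] {C : ℝ} {u : ℝ → E}
    (hu : StronglyMeasurable u) (hC : ∀ t, ‖u t‖ ≤ C) {x : E} (h : Tendsto u atTop (𝓝 x)) :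
    Tendsto (fun b : ℝ => b⁻¹ • ∫ t in (0 : ℝ)..b, u t) atTop (𝓝 x) := by
  have hscaled : Tendsto (fun b : ℝ => ∫ s in (0 : ℝ)..1, u (b * s)) atTop
      (𝓝 (∫ _ in (0 : ℝ)..1, x)) := by
    refine intervalIntegral.tendsto_integral_filter_of_dominated_convergence (fun _ => C)
      (Eventually.of_forall fun b =>
        (hu.comp_measurable (measurable_const_mul b)).aestronglyMeasurable)
      (Eventually.of_forall fun b => ae_of_all _ fun s _ => hC _) intervalIntegrable_const
      (ae_of_all _ fun s hs => ?_)
    rw [Set.uIoc_of_le zero_le_one] at hs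
    exact h.comp (tendsto_id.atTop_mul_const hs.1)
  rw [intervalIntegral.integral_const, sub_zero, one_smul] at hscaled
  refine hscaled.congr' ?_
  filter_upwards [eventually_ne_atTop 0] with b hb
  rw [intervalIntegral.integral_comp_mul_left u hb, mul_zero, mul_one]

end Averages

theorem indepFun_comp_of_measurePreserving {α β γ δ : Type*} [MeasurableSpace α]
    [MeasurableSpace β] [MeasurableSpace γ] [MeasurableSpace δ] {μ : Measure α} {ν : Measure β}
    {s : α → β} (hs : MeasurePreserving s μ ν) {f : β → γ} {g : β → δ} (hf : Measurable f)
    (hg : Measurable g) (h : IndepFun f g ν) : IndepFun (f ∘ s) (g ∘ s) μ := by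
  rw [indepFun_iff_measure_inter_preimage_eq_mul] at h ⊢
  intro A B hA hB
  rw [Set.preimage_comp, Set.preimage_comp, ← Set.preimage_inter,
    hs.measure_preimage ((hf hA).inter (hg hB)).nullMeasurableSet,
    hs.measure_preimage (hf hA).nullMeasurableSet, hs.measure_preimage (hg hB).nullMeasurableSet,
    h A B hA hB]

section ProdMk

variable {W A B : Type*} [MeasurableSpace W] [MeasurableSpace A] [MeasurableSpace B]
  {π : Measure W} [IsFiniteMeasure π] {μ : Measure A} {ν : Measure B} {f : W → A} {g : W → B}

theorem indepFun_of_measurePreserving_prodMk [IsProbabilityMeasure μ] [IsProbabilityMeasure ν]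
    (h : MeasurePreserving (fun w => (f w, g w)) π (μ.prod ν)) : IndepFun f g π := by
  have hf : MeasurePreserving f π μ := measurePreserving_fst.comp h
  have hg : MeasurePreserving g π ν := measurePreserving_snd.comp h
  rw [indepFun_iff_map_prod_eq_prod_map_map hf.measurable.aemeasurable hg.measurable.aemeasurable,
    h.map_eq, hf.map_eq, hg.map_eq]

theorem measurePreserving_prodMk_of_indepFun (hf : MeasurePreserving f π μ)
    (hg : MeasurePreserving g π ν) (h : IndepFun f g π) :
    MeasurePreserving (fun w => (f w, g w)) π (μ.prod ν) := by
  refine ⟨hf.measurable.prodMk hg.measurable, ?_⟩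
  rw [h.map_prod_eq_prod_map_map hf.measurable.aemeasurable hg.measurable.aemeasurable, hf.map_eq,
    hg.map_eq]

end ProdMk

section Regeneration

variable {W S E : Type*} [MeasurableSpace W] [MeasurableSpace S] {π : Measure W} {κ : Measure S}
  [IsProbabilityMeasure π] [IsProbabilityMeasure κ] {c : W → S} {θ : W → W}
  [NormedAddCommGroup E] [NormedSpace ℝ E] [CompleteSpace E] [MeasurableSpace E]
  [BorelSpace E]

theorem ae_tendsto_average_of_regenerative
    (h : MeasurePreserving (fun w => (c w, θ w)) π (κ.prod π)) {g : S → E} (hg : Measurable g)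
    (hgi : Integrable (fun w => g (c w)) π) :
    ∀ᵐ w ∂π, Tendsto (fun n : ℕ => (n : ℝ)⁻¹ • ∑ j ∈ Finset.range n, g (c (θ^[j] w))) atTop
      (𝓝 (∫ w, g (c w) ∂π)) := by
  have hθ : MeasurePreserving θ π π := measurePreserving_snd.comp h
  have hgc : Measurable (g ∘ c) := hg.comp (measurePreserving_fst.comp h).measurable
  have hindep : ∀ i l : ℕ, IndepFun (fun w => g (c (θ^[i] w)))
      (fun w => g (c (θ^[i + l + 1] w))) π := by
    intro i l
    have h0 : IndepFun (g ∘ c) (g ∘ c ∘ θ^[l] ∘ θ) π :=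
      (indepFun_of_measurePreserving_prodMk h).comp hg (hgc.comp (hθ.iterate l).measurable)
    have hi := indepFun_comp_of_measurePreserving (hθ.iterate i) hgc
      (hgc.comp ((hθ.iterate l).comp hθ).measurable) h0
    simpa only [Function.comp_def, ← Function.iterate_succ_apply, ← Function.iterate_add_apply,
      show l + 1 + i = i + l + 1 by omega] using hi
  have hpair : Pairwise fun i j =>
      IndepFun (fun w => g (c (θ^[i] w))) (fun w => g (c (θ^[j] w))) π := by
    intro i j hij
    rcases hij.lt_or_gt with hlt | hlt <;> obtain ⟨l, rfl⟩ := Nat.exists_eq_add_of_lt hlt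
    exacts [hindep i l, (hindep j l).symm]
  have hident : ∀ i, IdentDistrib θ^[i] id π π := fun i =>
    ⟨(hθ.iterate i).measurable.aemeasurable, aemeasurable_id, by
      rw [(hθ.iterate i).map_eq, Measure.map_id]⟩
  exact strong_law_ae (fun j w => g (c (θ^[j] w))) hgi hpair fun i => (hident i).comp hgc

theorem ae_tendsto_average_two_blocks_of_regenerative
    (h : MeasurePreserving (fun w => (c w, θ w)) π (κ.prod π)) {g : S × S → E} (hg : Measurable g)
    (hgi : Integrable (fun w => g (c w, c (θ w))) π) :
    ∀ᵐ w ∂π, Tendsto (fun n : ℕ =>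
        (n : ℝ)⁻¹ • ∑ j ∈ Finset.range n, g (c (θ^[j] w), c (θ^[j + 1] w))) atTop
      (𝓝 (∫ w, g (c w, c (θ w)) ∂π)) := by
  have hθ : MeasurePreserving θ π π := measurePreserving_snd.comp h
  have hblocks : MeasurePreserving (fun w => ((c w, c (θ w)), θ (θ w))) π ((κ.prod κ).prod π) :=
    (MeasurePreserving.symm MeasurableEquiv.prodAssoc (measurePreserving_prodAssoc κ κ π)).comp
      (((MeasurePreserving.id κ).prod h).comp h)
  have hiter : ∀ j, (fun w => θ (θ w))^[j] = θ^[2 * j] := fun j => by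
    rw [Function.iterate_mul]; rfl
  have hlln := ae_tendsto_average_of_regenerative hblocks hg hgi
  simp only [hiter, ← Function.iterate_succ_apply' θ] at hlln
  filter_upwards [hlln, hθ.quasiMeasurePreserving.ae hlln] with w heven hodd
  exact tendsto_average_of_even_odd heven hodd

end Regeneration

theorem measurable_comp_index {α β : Type*} [MeasurableSpace α] [MeasurableSpace β]
    {f : ℕ → α → β} (hf : ∀ n, Measurable (f n)) {T : α → ℕ} (hT : Measurable T) :
    Measurable fun a => f (T a) a := by
  have hf' : Measurable fun p : ℕ × α => f p.1 p.2 := measurable_from_prod_countable_right hf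
  exact hf'.comp (hT.prodMk measurable_id)

theorem measurable_sInf_nat {α : Type*} [MeasurableSpace α] {s : ℕ → α → Prop}
    (hs : ∀ n, MeasurableSet {a | s n a}) : Measurable fun a => sInf {n | s n a} := by
  classical
  have hex : ∀ a, ∃ n, s n a ∨ ∀ m, ¬ s m a := fun a => by
    by_cases h : ∃ n, s n a
    exacts [h.imp fun _ => Or.inl, ⟨0, Or.inr (not_exists.1 h)⟩]
  have hfind : (fun a => sInf {n | s n a}) = fun a => Nat.find (hex a) := by
    funext a
    symm
    rw [Nat.find_eq_iff]
    by_cases h : {n | s n a}.Nonempty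
    · exact ⟨Or.inl (Nat.sInf_mem h), fun n hn => not_or.2
        ⟨Nat.notMem_of_lt_sInf hn, fun hnone => h.elim hnone⟩⟩
    · rw [Set.not_nonempty_iff_eq_empty.1 h, Nat.sInf_empty]
      exact ⟨Or.inr fun m hm => h ⟨m, hm⟩, fun n hn => absurd hn n.not_lt_zero⟩
  have hnone : MeasurableSet {a | ∀ m, ¬ s m a} := by
    simp only [Set.ofPred_forall]
    exact MeasurableSet.iInter fun m => (hs m).compl
  rw [hfind]
  exact measurable_find hex fun n => (hs n).union hnone

theorem measure_eq_tsum_inter_fiber {α ι : Type*} [MeasurableSpace α] [MeasurableSpace ι]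
    [MeasurableSingletonClass ι] [Countable ι] {μ : Measure α} {T : α → ι} (hT : Measurable T)
    (s : Set α) : μ s = ∑' i, μ (T ⁻¹' {i} ∩ s) := by
  have hfiber : ∀ i, MeasurableSet (T ⁻¹' {i}) := fun i => hT (measurableSet_singleton i)
  rw [← Measure.restrict_apply_univ, ← Set.preimage_univ (f := T), ← Set.iUnion_of_singleton ι,
    Set.preimage_iUnion, measure_iUnion (pairwise_disjoint_fiber T) hfiber]
  exact tsum_congr fun i => Measure.restrict_apply (hfiber i)

section StrongMarkov

variable {Ω R S : Type*} [mΩ : MeasurableSpace Ω] [MeasurableSpace R] [MeasurableSpace S]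
  {P : Measure Ω} {κ : Measure R} {m : ℕ → MeasurableSpace Ω} {Y : ℕ → Ω → R}

theorem measure_inter_preimage_of_indep (hY : ∀ j, MeasurePreserving (Y j) P κ)
    (hind : ∀ j, Indep (m j) (MeasurableSpace.comap (Y j) inferInstance) P) {j : ℕ} {E : Set Ω}
    (hE : MeasurableSet[m j] E) {C : Set R} (hC : MeasurableSet C) :
    P (E ∩ Y j ⁻¹' C) = P E * κ C := by
  rw [(Indep_iff _ _ _).1 (hind j) E _ hE ⟨C, hC, rfl⟩,
    (hY j).measure_preimage hC.nullMeasurableSet]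

theorem measurePreserving_stopped [IsFiniteMeasure P] [SigmaFinite κ] (hm : ∀ j, m j ≤ mΩ)
    (hY : ∀ j, MeasurePreserving (Y j) P κ)
    (hind : ∀ j, Indep (m j) (MeasurableSpace.comap (Y j) inferInstance) P) {T : Ω → ℕ}
    (hT : Measurable T) (hTm : ∀ j, EventuallyMeasurableSet (m j) (ae P) (T ⁻¹' {j}))
    {g : ℕ → Ω → S} (hg : ∀ j, Measurable[m j] (g j)) :
    MeasurePreserving (fun ω => (g (T ω) ω, Y (T ω) ω)) P
      ((P.map fun ω => g (T ω) ω).prod κ) := by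
  have hgT : Measurable fun ω => g (T ω) ω :=
    measurable_comp_index (fun j => (hg j).mono (hm j) le_rfl) hT
  have hYT : Measurable fun ω => Y (T ω) ω :=
    measurable_comp_index (fun j => (hY j).measurable) hT
  refine ⟨hgT.prodMk hYT, (Measure.prod_eq fun A C hA hC => ?_).symm⟩
  rw [Measure.map_apply (hgT.prodMk hYT) (hA.prod hC), Measure.map_apply hgT hA,
    measure_eq_tsum_inter_fiber hT, measure_eq_tsum_inter_fiber hT (_ ⁻¹' A),
    ← ENNReal.tsum_mul_right]
  refine tsum_congr fun j => ?_
  obtain ⟨B, hB, hTB⟩ := hTm j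
  calc P (T ⁻¹' {j} ∩ (fun ω => (g (T ω) ω, Y (T ω) ω)) ⁻¹' A ×ˢ C)
      = P (T ⁻¹' {j} ∩ g j ⁻¹' A ∩ Y j ⁻¹' C) := by
        congr 1
        ext ω
        simp only [Set.mem_inter_iff, Set.mem_preimage, Set.mem_singleton_iff, Set.mem_prod,
          and_assoc]
        exact and_congr_right fun h => by rw [h]
    _ = P (B ∩ g j ⁻¹' A ∩ Y j ⁻¹' C) :=
        measure_congr ((hTB.inter ae_eq_rfl).inter ae_eq_rfl)
    _ = P (B ∩ g j ⁻¹' A) * κ C := measure_inter_preimage_of_indep hY hind (hB.inter (hg j hA)) hC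
    _ = P (T ⁻¹' {j} ∩ g j ⁻¹' A) * κ C := by
        rw [measure_congr (hTB.inter (ae_eq_refl (g j ⁻¹' A)))]
    _ = P (T ⁻¹' {j} ∩ (fun ω => g (T ω) ω) ⁻¹' A) * κ C := by
        congr 2
        ext ω
        exact and_congr_right fun h => by rw [Set.mem_preimage, Set.mem_preimage, h]

theorem lintegral_tsum_indicator_of_indep (hm : ∀ j, m j ≤ mΩ)
    (hY : ∀ j, MeasurePreserving (Y j) P κ)
    (hind : ∀ j, Indep (m j) (MeasurableSpace.comap (Y j) inferInstance) P) {E : ℕ → Set Ω}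
    (hE : ∀ j, MeasurableSet[m j] (E j)) {f : R → ENNReal} (hf : Measurable f) :
    ∫⁻ ω, ∑' j, (E j).indicator (fun ω => f (Y j ω)) ω ∂P = (∑' j, P (E j)) * ∫⁻ r, f r ∂κ := by
  have hfY : ∀ j, Measurable fun ω => f (Y j ω) := fun j => hf.comp (hY j).measurable
  rw [lintegral_tsum fun j => ((hfY j).indicator (hm j _ (hE j))).aemeasurable,
    ← ENNReal.tsum_mul_right]
  refine tsum_congr fun j => ?_
  calc ∫⁻ ω, (E j).indicator (fun ω => f (Y j ω)) ω ∂P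
      = ∫⁻ ω, (E j).indicator 1 ω * f (Y j ω) ∂P := by
        refine lintegral_congr fun ω => ?_
        by_cases hω : ω ∈ E j <;> simp [hω]
    _ = (∫⁻ ω, (E j).indicator 1 ω ∂P) * ∫⁻ ω, f (Y j ω) ∂P :=
        lintegral_mul_eq_lintegral_mul_lintegral_of_independent_measurableSpace (hm j)
          (hY j).measurable.comap_le (hind j)
          (Measurable.indicator (m := m j) measurable_const (hE j))
          (hf.comp (comap_measurable (Y j)))
    _ = P (E j) * ∫⁻ r, f r ∂κ := by
        rw [lintegral_indicator_one (hm j _ (hE j)), (hY j).lintegral_comp hf]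

end StrongMarkov

section IID

theorem indepFun_restrict_of_disjoint {ι Ω : Type*} {β : ι → Type*} [MeasurableSpace Ω]
    [∀ i, MeasurableSpace (β i)] {μ : Measure Ω} {f : ∀ i, Ω → β i} (hf : ∀ i, Measurable (f i))
    (h : iIndepFun f μ) {s t : Set ι} (hst : Disjoint s t) :
    IndepFun (fun ω (i : s) => f i ω) (fun ω (i : t) => f i ω) μ := by
  have hcomap : ∀ r : Set ι, MeasurableSpace.comap (fun ω (i : r) => f i ω) MeasurableSpace.pi =
      ⨆ i ∈ r, MeasurableSpace.comap (f i) inferInstance := fun r => by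
    simp only [MeasurableSpace.pi, MeasurableSpace.comap_iSup, MeasurableSpace.comap_comp,
      iSup_subtype']
    rfl
  rw [IndepFun_iff_Indep, hcomap, hcomap]
  exact indep_iSup_of_disjoint (fun i => (hf i).comap_le) h hst

variable {E : Type*} [MeasurableSpace E]

/-- The law of an i.i.d. sequence with marginal `ν`. -/
noncomputable abbrev iidLaw (ν : Measure E) : Measure (ℕ → E) := Measure.infinitePi fun _ => ν

/-- The sequence `z` without its first `j` terms. -/
def seqShift (j : ℕ) (z : ℕ → E) : ℕ → E := fun i => z (j + i)

/-- For a pair of an initial state and a sequence, the information contained in the initial state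
and the first `j` terms. -/
abbrev pastMeasurableSpace (S E : Type*) [MeasurableSpace S] [MeasurableSpace E] (j : ℕ) :
    MeasurableSpace (S × (ℕ → E)) :=
  MeasurableSpace.comap (fun p => (p.1, fun i : Set.Iio j => p.2 i)) inferInstance

theorem measurable_seqShift (j : ℕ) : Measurable (seqShift (E := E) j) :=
  measurable_pi_lambda _ fun i => measurable_pi_apply (j + i)

variable {S : Type*} [MeasurableSpace S]

theorem pastMeasurableSpace_le (j : ℕ) : pastMeasurableSpace S E j ≤ Prod.instMeasurableSpace :=
  Measurable.comap_le (by fun_prop)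

variable (σ : Measure S) [IsProbabilityMeasure σ] (ν : Measure E) [IsProbabilityMeasure ν]

theorem measurePreserving_seqShift (j : ℕ) :
    MeasurePreserving (seqShift j) (iidLaw ν) (iidLaw ν) :=
  ⟨measurable_seqShift j, Measure.map_infinitePi_infinitePi_of_inj (P := fun _ : ℕ => ν)
    (f := fun i => j + i) (add_right_injective j)⟩

theorem indepFun_restrict_Iio_seqShift (j : ℕ) :
    IndepFun (fun z (i : Set.Iio j) => z i) (seqShift j) (iidLaw ν) := by
  have hiid : iIndepFun (fun (i : ℕ) (z : ℕ → E) => z i) (iidLaw ν) :=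
    iIndepFun_infinitePi (P := fun _ : ℕ => ν) (X := fun _ x => x) fun _ => measurable_id
  exact (indepFun_restrict_of_disjoint measurable_pi_apply hiid
    (Set.Iio_disjoint_Ici le_rfl : Disjoint (Set.Iio j) (Set.Ici j))).comp measurable_id
    (measurable_pi_lambda _ fun i =>
      measurable_pi_apply (⟨j + i, Nat.le_add_right j i⟩ : Set.Ici j))

theorem measurePreserving_head_tail :
    MeasurePreserving (fun z : ℕ → E => (z 0, seqShift 1 z)) (iidLaw ν) (ν.prod (iidLaw ν)) :=
  measurePreserving_prodMk_of_indepFun (measurePreserving_eval_infinitePi (fun _ : ℕ => ν) 0)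
    (measurePreserving_seqShift ν 1)
    ((indepFun_restrict_Iio_seqShift ν 1).comp
      (measurable_pi_apply (⟨0, Nat.one_pos⟩ : Set.Iio 1)) measurable_id)

theorem indep_pastMeasurableSpace_seqShift (j : ℕ) :
    Indep (pastMeasurableSpace S E j)
      (MeasurableSpace.comap (fun p : S × (ℕ → E) => seqShift j p.2) inferInstance)
      (σ.prod (iidLaw ν)) := by
  have hhead : Measurable fun (z : ℕ → E) (i : Set.Iio j) => z i := by fun_prop
  have hsplit := measurePreserving_prodMk_of_indepFun (hhead.measurePreserving _)
    (measurePreserving_seqShift ν j) (indepFun_restrict_Iio_seqShift ν j)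
  have := Measure.isProbabilityMeasure_map (μ := iidLaw ν) hhead.aemeasurable
  exact indepFun_of_measurePreserving_prodMk ((MeasurePreserving.symm MeasurableEquiv.prodAssoc
    (measurePreserving_prodAssoc _ _ _)).comp ((MeasurePreserving.id σ).prod hsplit))

end IID

section FirstPassage

/-- The sequences of inter-arrival times of a renewal process without explosion: non-negative terms
whose partial sums reach every level. -/
structure IsRenewalSeq (z : ℕ → ℝ) : Prop where
  nonneg : ∀ i, 0 ≤ z i
  exists_le_sum : ∀ x : ℝ, ∃ n, x ≤ ∑ i ∈ Finset.range n, z i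

/-- The first index, from `l` on, at which the partial sums of `z` reach the level `x`; it is `0`
if the level is never reached. -/
noncomputable def passage (l : ℕ) (x : ℝ) (z : ℕ → ℝ) : ℕ :=
  sInf {n | l ≤ n ∧ x ≤ ∑ i ∈ Finset.range n, z i}

namespace IsRenewalSeq

variable {z : ℕ → ℝ} {l j : ℕ} {x : ℝ}

theorem exists_le_sum_of_le (hz : IsRenewalSeq z) (l : ℕ) (x : ℝ) :
    ∃ n, l ≤ n ∧ x ≤ ∑ i ∈ Finset.range n, z i := by
  obtain ⟨n, hn⟩ := hz.exists_le_sum x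
  refine ⟨max l n, le_max_left l n, hn.trans ?_⟩
  exact Finset.sum_le_sum_of_subset_of_nonneg (Finset.range_mono (le_max_right l n))
    fun i _ _ => hz.nonneg i

theorem seqShift (hz : IsRenewalSeq z) (j : ℕ) : IsRenewalSeq (seqShift j z) := by
  refine ⟨fun i => hz.nonneg (j + i), fun x => ?_⟩
  obtain ⟨n, hjn, hn⟩ := hz.exists_le_sum_of_le j (∑ i ∈ Finset.range j, z i + x)
  obtain ⟨m, rfl⟩ := Nat.exists_eq_add_of_le hjn
  rw [Finset.sum_range_add] at hn
  exact ⟨m, le_of_add_le_add_left hn⟩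

theorem le_passage (hz : IsRenewalSeq z) (l : ℕ) (x : ℝ) : l ≤ passage l x z :=
  (Nat.sInf_mem (hz.exists_le_sum_of_le l x)).1

theorem le_sum_passage (hz : IsRenewalSeq z) (l : ℕ) (x : ℝ) :
    x ≤ ∑ i ∈ Finset.range (passage l x z), z i :=
  (Nat.sInf_mem (hz.exists_le_sum_of_le l x)).2

theorem le_passage_iff (hz : IsRenewalSeq z) :
    j ≤ passage l x z ↔ ∀ i < j, l ≤ i → ∑ k ∈ Finset.range i, z k < x :=
  ⟨fun h _ hi hli => not_le.1 fun hx => Nat.notMem_of_lt_sInf (hi.trans_le h) ⟨hli, hx⟩,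
    fun h => not_lt.1 fun hlt =>
      (h _ hlt (hz.le_passage l x)).not_ge (hz.le_sum_passage l x)⟩

theorem sum_passage_sub_one_le (hz : IsRenewalSeq z) (hx : 0 ≤ x) :
    ∑ i ∈ Finset.range (passage 1 x z - 1), z i ≤ x := by
  have hpos := hz.le_passage 1 x
  rcases Nat.eq_zero_or_pos (passage 1 x z - 1) with h | h
  · rwa [h, Finset.sum_range_zero]
  · exact (hz.le_passage_iff.1 le_rfl _ (Nat.sub_lt hpos one_pos) h).le

theorem sum_passage (hz : IsRenewalSeq z) (x : ℝ) :
    ∑ i ∈ Finset.range (passage 1 x z), z i =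
      ∑ i ∈ Finset.range (passage 1 x z - 1), z i + z (passage 1 x z - 1) := by
  rw [← Finset.sum_range_succ, Nat.sub_add_cancel (hz.le_passage 1 x)]

theorem sum_min_one_passage_le (hz : IsRenewalSeq z) (hx : 0 ≤ x) :
    ∑ i ∈ Finset.range (passage 1 x z), min (z i) 1 ≤ x + 1 := by
  rw [← Nat.sub_add_cancel (hz.le_passage 1 x), Finset.sum_range_succ]
  refine add_le_add (le_trans ?_ (hz.sum_passage_sub_one_le hx)) (min_le_right _ _)
  exact Finset.sum_le_sum fun i _ => min_le_left _ _

end IsRenewalSeq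

theorem measurable_passage (l : ℕ) :
    Measurable fun p : ℝ × (ℕ → ℝ) => passage l p.1 p.2 :=
  measurable_sInf_nat fun n => (MeasurableSet.const (l ≤ n)).inter
    (measurableSet_le measurable_fst (by fun_prop))

theorem measurable_past {S E : Type*} [MeasurableSpace S] [MeasurableSpace E] (j : ℕ) :
    Measurable[pastMeasurableSpace S E j]
      fun p : S × (ℕ → E) => (p.1, fun i : Set.Iio j => p.2 i) :=
  comap_measurable _

theorem measurable_past_sum_range {S : Type*} [MeasurableSpace S] {i j : ℕ} (hij : i ≤ j) :
    Measurable[pastMeasurableSpace S ℝ j]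
      fun p : S × (ℕ → ℝ) => ∑ k ∈ Finset.range i, p.2 k := by
  refine Finset.measurable_fun_sum _ fun k hk => ?_
  have hkj : k < j := (Finset.mem_range.1 hk).trans_le hij
  exact (measurable_pi_apply (⟨k, hkj⟩ : Set.Iio j)).comp (measurable_snd.comp (measurable_past j))

/-- The event that no index in `[l, j)` reaches the level `p.1`. For a renewal sequence `p.2` this
means `j ≤ passage l p.1 p.2`. -/
def unreached (l j : ℕ) : Set (ℝ × (ℕ → ℝ)) :=
  {p | ∀ i < j, l ≤ i → ∑ k ∈ Finset.range i, p.2 k < p.1}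

theorem measurableSet_past_unreached (l : ℕ) {i j : ℕ} (hij : i ≤ j + 1) :
    MeasurableSet[pastMeasurableSpace ℝ ℝ j] (unreached l i) := by
  simp only [unreached, Set.ofPred_forall]
  exact MeasurableSet.iInter fun k => MeasurableSet.iInter fun hk => MeasurableSet.iInter fun _ =>
    measurableSet_lt (measurable_past_sum_range (by omega)) (measurable_past j).fst

theorem ae_isRenewalSeq {ν : Measure ℝ} [IsProbabilityMeasure ν] (h0 : ∀ᵐ a ∂ν, 0 ≤ a)
    (hpos : 0 < ∫ a, a ∂ν) : ∀ᵐ z ∂iidLaw ν, IsRenewalSeq z := by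
  have hev : ∀ i, MeasurePreserving (fun z : ℕ → ℝ => z i) (iidLaw ν) ν := fun i =>
    measurePreserving_eval_infinitePi (fun _ : ℕ => ν) i
  have hiid : iIndepFun (fun (i : ℕ) (z : ℕ → ℝ) => z i) (iidLaw ν) :=
    iIndepFun_infinitePi (P := fun _ : ℕ => ν) (X := fun _ x => x) fun _ => measurable_id
  have hident : ∀ i, IdentDistrib (fun z : ℕ → ℝ => z i) (fun z => z 0) (iidLaw ν) (iidLaw ν) :=
    fun i => ⟨(hev i).aemeasurable, (hev 0).aemeasurable, (hev i).map_eq.trans (hev 0).map_eq.symm⟩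
  have hint : ∫ z, z 0 ∂iidLaw ν = ∫ a, a ∂ν := by
    rw [← (hev 0).map_eq, integral_map (hev 0).aemeasurable (by fun_prop), (hev 0).map_eq]
  have hslln := strong_law_ae_real (fun (i : ℕ) (z : ℕ → ℝ) => z i)
    (Integrable.of_integral_ne_zero (hint ▸ hpos.ne')) (fun i j hij => hiid.indepFun hij) hident
  have hnonneg : ∀ᵐ z ∂iidLaw ν, ∀ i, 0 ≤ z i :=
    ae_all_iff.2 fun i => (hev i).quasiMeasurePreserving.ae h0
  filter_upwards [hslln, hnonneg] with z hz hz0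
  have hdiv : Tendsto (fun n : ℕ => ∑ i ∈ Finset.range n, z i) atTop atTop := by
    refine (hz.pos_mul_atTop (hint ▸ hpos) (tendsto_natCast_atTop_atTop (R := ℝ))).congr' ?_
    filter_upwards [eventually_ne_atTop 0] with n hn
    exact div_mul_cancel₀ _ (Nat.cast_ne_zero.2 hn)
  exact ⟨hz0, fun x => (hdiv.eventually_ge_atTop x).exists⟩

theorem eventuallyMeasurableSet_past_passage (σ ν : Measure ℝ)
    (hz : ∀ᵐ z ∂iidLaw ν, IsRenewalSeq z) (l j : ℕ) :
    EventuallyMeasurableSet (pastMeasurableSpace ℝ ℝ j) (ae (σ.prod (iidLaw ν)))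
      ((fun p => passage l p.1 p.2) ⁻¹' {j}) := by
  refine ⟨unreached l j \ unreached l (j + 1), MeasurableSet.diff
    (measurableSet_past_unreached l j.le_succ) (measurableSet_past_unreached l le_rfl), ?_⟩
  rw [eventuallyEq_set]
  filter_upwards [Measure.quasiMeasurePreserving_snd.ae hz] with p hp
  rw [Set.mem_sdiff, unreached, unreached, Set.mem_ofPred_eq, Set.mem_ofPred_eq,
    ← hp.le_passage_iff, ← hp.le_passage_iff, Set.mem_preimage, Set.mem_singleton_iff]
  omega

variable (σ ν : Measure ℝ) [IsProbabilityMeasure σ] [IsProbabilityMeasure ν]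

theorem measurePreserving_prodMk_seqShift_passage (hz : ∀ᵐ z ∂iidLaw ν, IsRenewalSeq z) (l : ℕ)
    {S : Type*} [MeasurableSpace S] {g : ℕ → ℝ × (ℕ → ℝ) → S}
    (hg : ∀ j, Measurable[pastMeasurableSpace ℝ ℝ j] (g j)) :
    MeasurePreserving
      (fun p => (g (passage l p.1 p.2) p, seqShift (passage l p.1 p.2) p.2)) (σ.prod (iidLaw ν))
      (((σ.prod (iidLaw ν)).map fun p => g (passage l p.1 p.2) p).prod (iidLaw ν)) :=
  measurePreserving_stopped pastMeasurableSpace_le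
    (fun j => (measurePreserving_seqShift ν j).comp measurePreserving_snd)
    (indep_pastMeasurableSpace_seqShift σ ν) (measurable_passage l)
    (eventuallyMeasurableSet_past_passage σ ν hz l) hg

theorem measurePreserving_seqShift_passage (hz : ∀ᵐ z ∂iidLaw ν, IsRenewalSeq z) (l : ℕ) :
    MeasurePreserving (fun p : ℝ × (ℕ → ℝ) => seqShift (passage l p.1 p.2) p.2)
      (σ.prod (iidLaw ν)) (iidLaw ν) := by
  have := Measure.isProbabilityMeasure_map (μ := σ.prod (iidLaw ν)) (f := fun _ => ())
    aemeasurable_const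
  exact measurePreserving_snd.comp (measurePreserving_prodMk_seqShift_passage σ ν hz l
    (g := fun _ _ => ()) fun _ => measurable_const)

theorem lintegral_tsum_indicator_unreached (l : ℕ) {f : ℝ → ENNReal} (hf : Measurable f) :
    ∫⁻ p, ∑' j, (unreached l (j + 1)).indicator (fun p => f (p.2 j)) p ∂(σ.prod (iidLaw ν)) =
      (∑' j, σ.prod (iidLaw ν) (unreached l (j + 1))) * ∫⁻ a, f a ∂ν := by
  have hhead := measurePreserving_eval_infinitePi (fun _ : ℕ => ν) 0
  have hwald := lintegral_tsum_indicator_of_indep pastMeasurableSpace_le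
    (fun j => (measurePreserving_seqShift ν j).comp measurePreserving_snd)
    (indep_pastMeasurableSpace_seqShift σ ν)
    (fun j => measurableSet_past_unreached l (i := j + 1) le_rfl)
    (hf.comp (measurable_pi_apply 0))
  rw [← hhead.lintegral_comp hf]
  exact hwald

theorem lintegral_min_one_ne_zero {ν : Measure ℝ} (h0 : ∀ᵐ a ∂ν, 0 ≤ a) (hpos : 0 < ∫ a, a ∂ν) :
    ∫⁻ a, ENNReal.ofReal (min a 1) ∂ν ≠ 0 := by
  intro h
  rw [lintegral_eq_zero_iff (by fun_prop)] at h
  refine hpos.ne' (integral_eq_zero_of_ae ?_)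
  filter_upwards [h, h0] with a ha ha0
  rcases min_le_iff.1 (ENNReal.ofReal_eq_zero.1 ha) with h | h
  exacts [le_antisymm h ha0, absurd h (by norm_num)]

theorem tsum_measure_unreached_ne_top (hσ0 : ∀ᵐ a ∂σ, 0 ≤ a) (hσ : Integrable (fun a => a) σ)
    (h0 : ∀ᵐ a ∂ν, 0 ≤ a) (hpos : 0 < ∫ a, a ∂ν) :
    ∑' j, σ.prod (iidLaw ν) (unreached 1 (j + 1)) ≠ ⊤ := by
  -- Cutting the terms off at 1 makes every step cost at most 1, so that they add up to at most the
  -- level plus 1, even when the terms themselves are large.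
  refine ENNReal.lt_top_of_mul_ne_top_left (ne_top_of_le_ne_top
    (b := ∫⁻ a, ENNReal.ofReal (a + 1) ∂σ) (hσ.add (integrable_const 1)).lintegral_lt_top.ne ?_)
    (lintegral_min_one_ne_zero h0 hpos) |>.ne
  rw [← lintegral_tsum_indicator_unreached σ ν 1 (by fun_prop),
    ← (measurePreserving_fst (μ := σ) (ν := iidLaw ν)).lintegral_comp (by fun_prop)]
  refine lintegral_mono_ae ?_
  filter_upwards [Measure.quasiMeasurePreserving_snd.ae (ae_isRenewalSeq h0 hpos),
    Measure.quasiMeasurePreserving_fst.ae hσ0] with p hz hx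
  have hmem : ∀ j, p ∈ unreached 1 (j + 1) ↔ j < passage 1 p.1 p.2 := fun j =>
    hz.le_passage_iff.symm
  calc ∑' j, (unreached 1 (j + 1)).indicator (fun p => ENNReal.ofReal (min (p.2 j) 1)) p
      = ∑ j ∈ Finset.range (passage 1 p.1 p.2), ENNReal.ofReal (min (p.2 j) 1) := by
        rw [tsum_eq_sum fun j hj =>
          Set.indicator_of_notMem (mt (hmem j).1 (mt Finset.mem_range.2 hj)) _]
        exact Finset.sum_congr rfl fun j hj =>
          Set.indicator_of_mem ((hmem j).2 (Finset.mem_range.1 hj)) _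
    _ = ENNReal.ofReal (∑ j ∈ Finset.range (passage 1 p.1 p.2), min (p.2 j) 1) :=
        (ENNReal.ofReal_sum_of_nonneg fun j _ => le_min (hz.nonneg j) zero_le_one).symm
    _ ≤ ENNReal.ofReal (p.1 + 1) := ENNReal.ofReal_le_ofReal (hz.sum_min_one_passage_le hx)

theorem integrable_apply_passage_sub_one (hσ0 : ∀ᵐ a ∂σ, 0 ≤ a) (hσ : Integrable (fun a => a) σ)
    (h0 : ∀ᵐ a ∂ν, 0 ≤ a) (hpos : 0 < ∫ a, a ∂ν) :
    Integrable (fun p : ℝ × (ℕ → ℝ) => p.2 (passage 1 p.1 p.2 - 1)) (σ.prod (iidLaw ν)) := by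
  have hz := Measure.quasiMeasurePreserving_snd (μ := σ) |>.ae (ae_isRenewalSeq h0 hpos)
  have hmeas : Measurable fun p : ℝ × (ℕ → ℝ) => p.2 (passage 1 p.1 p.2 - 1) :=
    measurable_comp_index (f := fun n (p : ℝ × (ℕ → ℝ)) => p.2 (n - 1))
      (fun n => by fun_prop) (measurable_passage 1)
  refine ⟨hmeas.aestronglyMeasurable, ?_⟩
  rw [hasFiniteIntegral_iff_ofReal (hz.mono fun p hp => hp.nonneg _)]
  calc ∫⁻ p, ENNReal.ofReal (p.2 (passage 1 p.1 p.2 - 1)) ∂(σ.prod (iidLaw ν))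
      ≤ ∫⁻ p, ∑' j, (unreached 1 (j + 1)).indicator (fun p => ENNReal.ofReal (p.2 j)) p
          ∂(σ.prod (iidLaw ν)) := by
        refine lintegral_mono_ae (hz.mono fun p hp => ?_)
        have hmem : p ∈ unreached 1 (passage 1 p.1 p.2 - 1 + 1) :=
          hp.le_passage_iff.1 (Nat.sub_add_cancel (hp.le_passage 1 p.1)).le
        refine le_trans (le_of_eq ?_) (ENNReal.le_tsum (passage 1 p.1 p.2 - 1))
        rw [Set.indicator_of_mem hmem]
    _ = (∑' j, σ.prod (iidLaw ν) (unreached 1 (j + 1))) * ∫⁻ a, ENNReal.ofReal a ∂ν :=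
        lintegral_tsum_indicator_unreached σ ν 1 ENNReal.measurable_ofReal
    _ < ⊤ := ENNReal.mul_lt_top (tsum_measure_unreached_ne_top σ ν hσ0 hσ h0 hpos).lt_top
        (Integrable.of_integral_ne_zero hpos.ne').lintegral_lt_top

end FirstPassage

namespace GG11

section Cycle

/-- The service time `p.1` of a packet and the idle time after its departure, when `p.2` are the
inter-arrival times from its arrival on. -/
noncomputable def cycle (p : ℝ × (ℕ → ℝ)) : ℝ × ℝ :=
  (p.1, ∑ i ∈ Finset.range (passage 1 p.1 p.2), p.2 i - p.1)

/-- The first cycle of the system when a packet arrives at time `0`, `w.1` are the inter-arrival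
times and `w.2` the service times. -/
noncomputable def firstCycle (w : (ℕ → ℝ) × (ℕ → ℝ)) : ℝ × ℝ := cycle (w.2 0, w.1)

/-- The inter-arrival and service times seen by the next accepted packet, when `w.1` and `w.2` are
those seen by the current one. -/
noncomputable def advance (w : (ℕ → ℝ) × (ℕ → ℝ)) : (ℕ → ℝ) × (ℕ → ℝ) :=
  (seqShift (passage 1 (w.2 0) w.1) w.1, seqShift 1 w.2)

theorem measurable_cycle : Measurable cycle := by
  refine measurable_fst.prodMk (Measurable.sub ?_ measurable_fst)
  exact measurable_comp_index (f := fun n (p : ℝ × (ℕ → ℝ)) => ∑ i ∈ Finset.range n, p.2 i)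
    (fun n => by fun_prop) (measurable_passage 1)

variable (ν μ : Measure ℝ) [IsProbabilityMeasure ν] [IsProbabilityMeasure μ]

theorem measurePreserving_prodMk_cycle_seqShift (hz : ∀ᵐ z ∂iidLaw ν, IsRenewalSeq z) :
    MeasurePreserving (fun p : ℝ × (ℕ → ℝ) => (cycle p, seqShift (passage 1 p.1 p.2) p.2))
      (μ.prod (iidLaw ν)) (((μ.prod (iidLaw ν)).map cycle).prod (iidLaw ν)) :=
  measurePreserving_prodMk_seqShift_passage μ ν hz 1
    (g := fun j p => (p.1, ∑ i ∈ Finset.range j, p.2 i - p.1)) fun j =>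
      (measurable_past j).fst.prodMk
        ((measurable_past_sum_range le_rfl).sub (measurable_past j).fst)

theorem measurePreserving_head_prodMk_tail :
    MeasurePreserving (fun w : (ℕ → ℝ) × (ℕ → ℝ) => ((w.2 0, w.1), seqShift 1 w.2))
      ((iidLaw ν).prod (iidLaw μ)) ((μ.prod (iidLaw ν)).prod (iidLaw μ)) :=
  (Measure.measurePreserving_swap.prod (MeasurePreserving.id (iidLaw μ))).comp
    ((MeasurePreserving.symm MeasurableEquiv.prodAssoc
      (measurePreserving_prodAssoc (iidLaw ν) μ (iidLaw μ))).comp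
      ((MeasurePreserving.id (iidLaw ν)).prod (measurePreserving_head_tail μ)))

theorem measurePreserving_prodMk_firstCycle_advance (hz : ∀ᵐ z ∂iidLaw ν, IsRenewalSeq z) :
    MeasurePreserving (fun w => (firstCycle w, advance w)) ((iidLaw ν).prod (iidLaw μ))
      (((μ.prod (iidLaw ν)).map cycle).prod ((iidLaw ν).prod (iidLaw μ))) :=
   (measurePreserving_prodAssoc _ _ _).comp
    (((measurePreserving_prodMk_cycle_seqShift ν μ hz).prod (MeasurePreserving.id _)).comp
      (measurePreserving_head_prodMk_tail ν μ))

end Cycle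

variable {Ω : Type*}

/-- The inter-arrival times from the arrival of packet `k` on, and the service times from packet `k`
on. -/
noncomputable def state (q : GG11 Ω) (k : ℕ) (ω : Ω) : (ℕ → ℝ) × (ℕ → ℝ) :=
  (seqShift (q.N k ω) fun n => q.Z n ω, seqShift k fun n => q.X n ω)

section Path

variable {q : GG11 Ω} {ω : Ω}

theorem S_add (i j : ℕ) :
    q.S (i + j) ω = q.S i ω + ∑ l ∈ Finset.range j, seqShift i (fun n => q.Z n ω) l := by
  rw [S, S, Finset.sum_range_add, add_assoc]
  rfl

theorem N_zero : q.N 0 ω = passage 0 (q.D ω - q.F ω) fun n => q.Z n ω := by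
  simp only [N, passage, S, sub_le_iff_le_add', Nat.zero_le, true_and]

theorem N_succ (hz : IsRenewalSeq fun n => q.Z n ω) (k : ℕ) :
    q.N (k + 1) ω = q.N k ω + passage 1 (q.X k ω) (q.state k ω).1 := by
  have hstate : IsRenewalSeq (q.state k ω).1 := hz.seqShift (q.N k ω)
  have hreach : ∀ j, q.S (q.N k ω) ω + q.X k ω ≤ q.S (q.N k ω + j) ω ↔
      q.X k ω ≤ ∑ i ∈ Finset.range j, (q.state k ω).1 i := fun j => by
    rw [S_add, add_le_add_iff_left]
    rfl
  refine IsLeast.csInf_eq (s := {n | q.N k ω < n ∧ q.S (q.N k ω) ω + q.X k ω ≤ q.S n ω})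
    ⟨⟨?_, (hreach _).2 (hstate.le_sum_passage 1 _)⟩, ?_⟩
  · exact Nat.lt_add_of_pos_right (hstate.le_passage 1 _)
  · rintro n ⟨hn, hle⟩
    obtain ⟨j, rfl⟩ := Nat.exists_eq_add_of_le hn.le
    exact Nat.add_le_add_left (Nat.sInf_le
      (s := {j | 1 ≤ j ∧ q.X k ω ≤ ∑ i ∈ Finset.range j, (q.state k ω).1 i})
      ⟨by omega, (hreach j).1 hle⟩) _

theorem state_succ (hz : IsRenewalSeq fun n => q.Z n ω) (k : ℕ) :
    q.state (k + 1) ω = advance (q.state k ω) := by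
  ext i
  · simp only [advance, state, seqShift, N_succ hz, add_assoc, add_zero]
  · simp only [advance, state, seqShift, add_assoc]

theorem state_eq_iterate (hz : IsRenewalSeq fun n => q.Z n ω) (i j : ℕ) :
    q.state (i + j) ω = advance^[j] (q.state i ω) := by
  induction j with
  | zero => rfl
  | succ j ih => rw [Function.iterate_succ_apply', ← ih, ← state_succ hz, add_assoc]

theorem idle_succ (hz : IsRenewalSeq fun n => q.Z n ω) (k : ℕ) :
    q.idle (k + 1) ω =
      ∑ i ∈ Finset.range (passage 1 (q.X k ω) (q.state k ω).1), (q.state k ω).1 i - q.X k ω := by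
  rw [idle, Nat.add_sub_cancel, TD, TA, TA, N_succ hz, S_add, add_sub_add_left_eq_sub]
  rfl

theorem firstCycle_state (hz : IsRenewalSeq fun n => q.Z n ω) (k : ℕ) :
    firstCycle (q.state k ω) = (q.X k ω, q.idle (k + 1) ω) :=
  Prod.ext rfl (idle_succ hz k).symm

theorem Zcheck_succ (hz : IsRenewalSeq fun n => q.Z n ω) (k : ℕ) :
    q.Zcheck (k + 1) ω = (q.state k ω).1 (passage 1 (q.X k ω) (q.state k ω).1 - 1) := by
  have hstate : IsRenewalSeq (q.state k ω).1 := hz.seqShift (q.N k ω)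
  rw [Zcheck, N_succ hz, Nat.add_sub_assoc (hstate.le_passage 1 _), S_add, S_add,
    add_sub_add_left_eq_sub, sub_eq_iff_eq_add']
  exact hstate.sum_passage (q.X k ω)

theorem idle_nonneg (hz : IsRenewalSeq fun n => q.Z n ω) (k : ℕ) : 0 ≤ q.idle (k + 1) ω := by
  rw [idle_succ hz]
  exact sub_nonneg.2 ((hz.seqShift (q.N k ω)).le_sum_passage 1 _)

theorem idle_le_Zcheck (hz : IsRenewalSeq fun n => q.Z n ω) {k : ℕ} (hx : 0 ≤ q.X k ω) :
    q.idle (k + 1) ω ≤ q.Zcheck (k + 1) ω := by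
  have hstate : IsRenewalSeq (q.state k ω).1 := hz.seqShift (q.N k ω)
  rw [idle_succ hz, Zcheck_succ hz, hstate.sum_passage, sub_le_iff_le_add']
  exact add_le_add_left (hstate.sum_passage_sub_one_le hx) _

theorem TD_succ (k : ℕ) : q.TD (k + 1) ω = q.TD k ω + (q.X (k + 1) ω + q.idle (k + 1) ω) := by
  rw [idle, Nat.add_sub_cancel, TD, TD]
  ring

theorem F_le_TA (hz : IsRenewalSeq fun n => q.Z n ω) (k : ℕ) : q.F ω ≤ q.TA k ω :=
  le_add_of_nonneg_right (Finset.sum_nonneg fun i _ => hz.nonneg i)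

theorem monotone_TD (hz : IsRenewalSeq fun n => q.Z n ω) (hx : ∀ k, 0 ≤ q.X k ω) :
    Monotone fun k => q.TD k ω :=
  monotone_nat_of_le_succ fun k => by
    rw [TD_succ]
    exact le_add_of_nonneg_right (add_nonneg (hx (k + 1)) (idle_nonneg hz k))

theorem monotone_TA (hz : IsRenewalSeq fun n => q.Z n ω) (hx : ∀ k, 0 ≤ q.X k ω) :
    Monotone fun k => q.TA k ω :=
  monotone_nat_of_le_succ fun k =>
    (le_add_of_nonneg_right (hx k)).trans (sub_nonneg.1 (idle_nonneg hz k))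

theorem aoi_eq_sub_TA (hz : IsRenewalSeq fun n => q.Z n ω) (hx : ∀ k, 0 ≤ q.X k ω)
    (hU : q.U ω ≤ q.F ω) (hA : q.A ω ≤ q.F ω) {k : ℕ} {t : ℝ} (hle : q.TD k ω ≤ t)
    (hlt : t < q.TD (k + 1) ω) : q.aoi t ω = t - q.TA k ω := by
  rw [aoi, IsGreatest.csSup_eq (a := q.TA k ω)]
  refine ⟨Or.inr ⟨k, rfl, hle⟩, ?_⟩
  rintro a ((rfl | ⟨rfl, -⟩) | ⟨j, rfl, hj⟩)
  · exact hU.trans (F_le_TA hz k)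
  · exact hA.trans (F_le_TA hz k)
  · refine monotone_TA hz hx (not_lt.1 fun hkj => ?_)
    exact (hj.trans_lt hlt).not_ge (monotone_TD hz hx hkj)

end Path

/-- The service time of packet `k` and the idle time after its departure. -/
noncomputable def cycleAt (q : GG11 Ω) (k : ℕ) (ω : Ω) : ℝ × ℝ := (q.X k ω, q.idle (k + 1) ω)

variable [MeasurableSpace Ω] {P : Measure Ω} {q : GG11 Ω}

/-- The joint law of the inter-arrival and service times, which is also that of `state q k`. -/
noncomputable def stateLaw (P : Measure Ω) (q : GG11 Ω) : Measure ((ℕ → ℝ) × (ℕ → ℝ)) :=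
  (iidLaw (P.map (q.Z 0))).prod (iidLaw (P.map (q.X 0)))

namespace IsGIGI11

section Measurability

theorem measurable_Zseq (hq : q.IsGIGI11 P) : Measurable fun ω n => q.Z n ω :=
  measurable_pi_lambda _ hq.measurable_Z

theorem measurable_Xseq (hq : q.IsGIGI11 P) : Measurable fun ω n => q.X n ω :=
  measurable_pi_lambda _ hq.measurable_X

theorem measurable_S (hq : q.IsGIGI11 P) (n : ℕ) : Measurable (q.S n) :=
  hq.measurable_F.add (Finset.measurable_fun_sum _ fun i _ => hq.measurable_Z i)

theorem measurable_N (hq : q.IsGIGI11 P) (k : ℕ) : Measurable (q.N k) := by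
  induction k with
  | zero => exact measurable_sInf_nat fun n => measurableSet_le hq.measurable_D (hq.measurable_S n)
  | succ k ih =>
    exact measurable_sInf_nat fun n => (measurableSet_lt ih measurable_const).inter
      (measurableSet_le ((measurable_comp_index hq.measurable_S ih).add (hq.measurable_X k))
        (hq.measurable_S n))

theorem measurable_TA (hq : q.IsGIGI11 P) (k : ℕ) : Measurable (q.TA k) :=
  measurable_comp_index hq.measurable_S (hq.measurable_N k)

theorem measurable_TD (hq : q.IsGIGI11 P) (k : ℕ) : Measurable (q.TD k) :=
  (hq.measurable_TA k).add (hq.measurable_X k)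

theorem measurable_idle (hq : q.IsGIGI11 P) (k : ℕ) : Measurable (q.idle k) :=
  (hq.measurable_TA k).sub (hq.measurable_TD (k - 1))

theorem measurable_Zcheck (hq : q.IsGIGI11 P) (k : ℕ) : Measurable (q.Zcheck k) :=
  (hq.measurable_TA k).sub (measurable_comp_index (f := fun n => q.S (n - 1))
    (fun n => hq.measurable_S (n - 1)) (hq.measurable_N k))

theorem measurable_gammaStar (hq : q.IsGIGI11 P) (d : ℝ) (k : ℕ) :
    Measurable (q.gammaStar d k) := by
  have := hq.measurable_idle k
  have := hq.measurable_X
  unfold gammaStar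
  fun_prop

theorem measurable_Gamma1 (hq : q.IsGIGI11 P) (d : ℝ) (k : ℕ) : Measurable (q.Gamma1 d k) := by
  have := hq.measurable_Zcheck k
  have := hq.measurable_X
  unfold Gamma1
  fun_prop

theorem measurable_state (hq : q.IsGIGI11 P) (k : ℕ) : Measurable (q.state k) :=
  (measurable_comp_index (f := fun n ω => seqShift n fun i => q.Z i ω)
    (fun n => (measurable_seqShift n).comp hq.measurable_Zseq) (hq.measurable_N k)).prodMk
    ((measurable_seqShift k).comp hq.measurable_Xseq)

end Measurability

section Law

theorem ae_nonneg_law_Z (hq : q.IsGIGI11 P) : ∀ᵐ a ∂P.map (q.Z 0), 0 ≤ a :=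
  (ae_map_iff (hq.measurable_Z 0).aemeasurable measurableSet_Ici).2 (hq.Z_nonneg 0)

theorem ae_nonneg_law_X (hq : q.IsGIGI11 P) : ∀ᵐ a ∂P.map (q.X 0), 0 ≤ a :=
  (ae_map_iff (hq.measurable_X 0).aemeasurable measurableSet_Ici).2 (hq.X_nonneg 0)

theorem integrable_law_X (hq : q.IsGIGI11 P) : Integrable (fun a => a) (P.map (q.X 0)) :=
  (integrable_map_measure (by fun_prop) (hq.measurable_X 0).aemeasurable).2 hq.X_integrable

theorem integral_law_Z_pos (hq : q.IsGIGI11 P) : 0 < ∫ a, a ∂P.map (q.Z 0) := by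
  rw [integral_map (hq.measurable_Z 0).aemeasurable (by fun_prop)]
  exact hq.Z_mean_pos

theorem measurePreserving_Z (hq : q.IsGIGI11 P) :
    MeasurePreserving (fun ω n => q.Z n ω) P (iidLaw (P.map (q.Z 0))) :=
  ⟨hq.measurable_Zseq, (hq.Z_indep.map_fun_eq_infinitePi_map hq.measurable_Z).trans
    (congrArg Measure.infinitePi (funext fun n => (hq.Z_ident n).map_eq))⟩

theorem measurePreserving_X (hq : q.IsGIGI11 P) :
    MeasurePreserving (fun ω n => q.X n ω) P (iidLaw (P.map (q.X 0))) :=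
  ⟨hq.measurable_Xseq, (hq.X_indep.map_fun_eq_infinitePi_map hq.measurable_X).trans
    (congrArg Measure.infinitePi (funext fun n => (hq.X_ident n).map_eq))⟩

variable [IsProbabilityMeasure P]

theorem isProbabilityMeasure_law_Z (hq : q.IsGIGI11 P) : IsProbabilityMeasure (P.map (q.Z 0)) :=
  Measure.isProbabilityMeasure_map (hq.measurable_Z 0).aemeasurable

theorem isProbabilityMeasure_law_X (hq : q.IsGIGI11 P) : IsProbabilityMeasure (P.map (q.X 0)) :=
  Measure.isProbabilityMeasure_map (hq.measurable_X 0).aemeasurable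

theorem ae_isRenewalSeq_law (hq : q.IsGIGI11 P) :
    ∀ᵐ z ∂iidLaw (P.map (q.Z 0)), IsRenewalSeq z :=
  have := hq.isProbabilityMeasure_law_Z
  ae_isRenewalSeq hq.ae_nonneg_law_Z hq.integral_law_Z_pos

theorem ae_isRenewalSeq (hq : q.IsGIGI11 P) : ∀ᵐ ω ∂P, IsRenewalSeq fun n => q.Z n ω :=
  hq.measurePreserving_Z.quasiMeasurePreserving.ae hq.ae_isRenewalSeq_law

theorem measurePreserving_ZX (hq : q.IsGIGI11 P) :
    MeasurePreserving (fun ω => ((fun n => q.Z n ω), (fun n => q.X n ω))) P (stateLaw P q) :=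
  measurePreserving_prodMk_of_indepFun hq.measurePreserving_Z hq.measurePreserving_X hq.ZX_indep

theorem measurePreserving_state_zero (hq : q.IsGIGI11 P) :
    MeasurePreserving (q.state 0) P (stateLaw P q) := by
  have := hq.isProbabilityMeasure_law_Z
  have := hq.isProbabilityMeasure_law_X
  set gap : Ω → ℝ := fun ω => q.D ω - q.F ω
  have hgap : Measurable gap := hq.measurable_D.sub hq.measurable_F
  have := Measure.isProbabilityMeasure_map (μ := P) hgap.aemeasurable
  have hindep : IndepFun gap (fun ω => ((fun n => q.Z n ω), (fun n => q.X n ω))) P :=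
    hq.init_indep.comp (φ := fun p : ℝ × ℝ × ℝ × ℝ => p.2.2.1 - p.1) (ψ := id)
      (by fun_prop) measurable_id
  have hsplit : MeasurePreserving (fun ω => ((gap ω, fun n => q.Z n ω), fun n => q.X n ω)) P
      (((P.map gap).prod (iidLaw (P.map (q.Z 0)))).prod (iidLaw (P.map (q.X 0)))) :=
    (MeasurePreserving.symm MeasurableEquiv.prodAssoc (measurePreserving_prodAssoc _ _ _)).comp
      (measurePreserving_prodMk_of_indepFun (hgap.measurePreserving P) hq.measurePreserving_ZX
        hindep)
  have hstate : q.state 0 = fun ω =>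
      (seqShift (passage 0 (gap ω) fun n => q.Z n ω) fun n => q.Z n ω, fun n => q.X n ω) := by
    funext ω
    refine Prod.ext (by simp only [state, N_zero, gap]) (funext fun i => ?_)
    simp only [state, seqShift, zero_add]
  rw [hstate]
  exact ((measurePreserving_seqShift_passage _ _ hq.ae_isRenewalSeq_law 0).prod
    (MeasurePreserving.id _)).comp hsplit

theorem measurePreserving_firstCycle_advance (hq : q.IsGIGI11 P) :
    MeasurePreserving (fun w => (firstCycle w, advance w)) (stateLaw P q)
      ((((P.map (q.X 0)).prod (iidLaw (P.map (q.Z 0)))).map cycle).prod (stateLaw P q)) :=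
  have := hq.isProbabilityMeasure_law_Z
  have := hq.isProbabilityMeasure_law_X
  measurePreserving_prodMk_firstCycle_advance _ _ hq.ae_isRenewalSeq_law

theorem isProbabilityMeasure_stateLaw (hq : q.IsGIGI11 P) :
    IsProbabilityMeasure (stateLaw P q) := by
  rw [← hq.measurePreserving_ZX.map_eq]
  exact Measure.isProbabilityMeasure_map hq.measurePreserving_ZX.aemeasurable

theorem measurePreserving_state (hq : q.IsGIGI11 P) (k : ℕ) :
    MeasurePreserving (q.state k) P (stateLaw P q) := by
  have := hq.isProbabilityMeasure_law_Z
  have := hq.isProbabilityMeasure_law_X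
  induction k with
  | zero => exact hq.measurePreserving_state_zero
  | succ k ih =>
    have hadvance : MeasurePreserving advance (stateLaw P q) (stateLaw P q) := by
      have := Measure.isProbabilityMeasure_map
        (μ := (P.map (q.X 0)).prod (iidLaw (P.map (q.Z 0)))) measurable_cycle.aemeasurable
      have := hq.isProbabilityMeasure_stateLaw
      exact measurePreserving_snd.comp hq.measurePreserving_firstCycle_advance
    refine ⟨hq.measurable_state _, Eq.trans ?_ (hadvance.comp ih).map_eq⟩
    refine Measure.map_congr ?_
    filter_upwards [hq.ae_isRenewalSeq] with ω hz using state_succ hz k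

theorem ae_tendsto_average (hq : q.IsGIGI11 P) {g : (ℝ × ℝ) × (ℝ × ℝ) → ℝ} (hg : Measurable g)
    (k : ℕ) (hgi : Integrable (fun ω => g (q.cycleAt k ω, q.cycleAt (k + 1) ω)) P) :
    ∀ᵐ ω ∂P, Tendsto
      (fun n : ℕ => (n : ℝ)⁻¹ • ∑ j ∈ Finset.range n, g (q.cycleAt j ω, q.cycleAt (j + 1) ω)) atTop
      (𝓝 (∫ ω, g (q.cycleAt k ω, q.cycleAt (k + 1) ω) ∂P)) := by
  have := hq.isProbabilityMeasure_law_Z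
  have := hq.isProbabilityMeasure_law_X
  have := hq.isProbabilityMeasure_stateLaw
  have := Measure.isProbabilityMeasure_map
    (μ := (P.map (q.X 0)).prod (iidLaw (P.map (q.Z 0)))) measurable_cycle.aemeasurable
  have hcycle : ∀ᵐ ω ∂P, ∀ j, q.cycleAt j ω = firstCycle (advance^[j] (q.state 0 ω)) := by
    filter_upwards [hq.ae_isRenewalSeq] with ω hz j
    rw [← state_eq_iterate hz, zero_add, firstCycle_state hz]
    rfl
  set G : (ℕ → ℝ) × (ℕ → ℝ) → ℝ := fun w => g (firstCycle w, firstCycle (advance w))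
  have hG : Measurable G := hg.comp
    (hq.measurePreserving_firstCycle_advance.measurable.fst.prodMk
      (hq.measurePreserving_firstCycle_advance.measurable.fst.comp
        hq.measurePreserving_firstCycle_advance.measurable.snd))
  have hstate : (fun ω => g (q.cycleAt k ω, q.cycleAt (k + 1) ω)) =ᵐ[P] G ∘ q.state k := by
    filter_upwards [hq.ae_isRenewalSeq] with ω hz
    simp only [G, Function.comp_apply, ← state_succ hz, firstCycle_state hz]
    rfl
  have hmean : ∫ ω, g (q.cycleAt k ω, q.cycleAt (k + 1) ω) ∂P = ∫ w, G w ∂stateLaw P q := by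
    rw [integral_congr_ae hstate, ← (hq.measurePreserving_state k).map_eq,
      integral_map (hq.measurable_state k).aemeasurable hG.aestronglyMeasurable]
    rfl
  have hGi : Integrable G (stateLaw P q) :=
    ((hq.measurePreserving_state k).integrable_comp hG.aestronglyMeasurable).1 (hgi.congr hstate)
  filter_upwards [hcycle, hq.measurePreserving_state_zero.quasiMeasurePreserving.ae
    (ae_tendsto_average_two_blocks_of_regenerative hq.measurePreserving_firstCycle_advance hg hGi)]
    with ω hω hlim
  simp only [hω]
  rwa [hmean]

end Law

section Integrability

theorem integrable_X (hq : q.IsGIGI11 P) (k : ℕ) : Integrable (q.X k) P :=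
  (hq.X_ident k).integrable_iff.2 hq.X_integrable

theorem integral_X_pos (hq : q.IsGIGI11 P) (k : ℕ) : 0 < ∫ ω, q.X k ω ∂P :=
  (hq.X_ident k).integral_eq ▸ hq.X_mean_pos

variable [IsProbabilityMeasure P]

theorem ae_Zcheck_nonneg (hq : q.IsGIGI11 P) (k : ℕ) : ∀ᵐ ω ∂P, 0 ≤ q.Zcheck (k + 1) ω := by
  filter_upwards [hq.ae_isRenewalSeq, hq.X_nonneg k] with ω hz hx
  exact (idle_nonneg hz k).trans (idle_le_Zcheck hz hx)

theorem integrable_Zcheck (hq : q.IsGIGI11 P) (k : ℕ) : Integrable (q.Zcheck (k + 1)) P := by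
  have := hq.isProbabilityMeasure_law_Z
  have := hq.isProbabilityMeasure_law_X
  have hhead := measurePreserving_fst.comp ((measurePreserving_head_prodMk_tail _ _).comp
    (hq.measurePreserving_state k))
  refine (hhead.integrable_comp_of_integrable (integrable_apply_passage_sub_one _ _
    hq.ae_nonneg_law_X hq.integrable_law_X hq.ae_nonneg_law_Z hq.integral_law_Z_pos)).congr ?_
  filter_upwards [hq.ae_isRenewalSeq] with ω hz using (Zcheck_succ hz k).symm

theorem integrable_idle (hq : q.IsGIGI11 P) (k : ℕ) : Integrable (q.idle (k + 1)) P := by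
  refine (hq.integrable_Zcheck k).mono' (hq.measurable_idle _).aestronglyMeasurable ?_
  filter_upwards [hq.ae_isRenewalSeq, hq.X_nonneg k] with ω hz hx
  rw [Real.norm_of_nonneg (idle_nonneg hz k)]
  exact idle_le_Zcheck hz hx

theorem integral_X_add_integral_idle_pos (hq : q.IsGIGI11 P) (k : ℕ) :
    0 < ∫ ω, q.X (k + 1) ω ∂P + ∫ ω, q.idle (k + 1) ω ∂P := by
  refine add_pos_of_pos_of_nonneg (hq.integral_X_pos (k + 1)) (integral_nonneg_of_ae ?_)
  filter_upwards [hq.ae_isRenewalSeq] with ω hz using idle_nonneg hz k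

theorem ae_gammaStar_nonneg (hq : q.IsGIGI11 P) (d : ℝ) (k : ℕ) :
    ∀ᵐ ω ∂P, 0 ≤ q.gammaStar d (k + 1) ω := by
  filter_upwards [hq.ae_isRenewalSeq, hq.X_nonneg (k + 1)] with ω hz hx
  exact le_min (le_max_left _ _) (add_nonneg hx (idle_nonneg hz k))

theorem integrable_gammaStar (hq : q.IsGIGI11 P) (d : ℝ) (k : ℕ) :
    Integrable (q.gammaStar d (k + 1)) P := by
  refine ((hq.integrable_X (k + 1)).add (hq.integrable_idle k)).mono'
    (hq.measurable_gammaStar d _).aestronglyMeasurable ?_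
  filter_upwards [hq.ae_gammaStar_nonneg d k] with ω h
  rw [Real.norm_of_nonneg h]
  exact min_le_right _ _

theorem ae_Gamma1_nonneg (hq : q.IsGIGI11 P) (d : ℝ) (k : ℕ) :
    ∀ᵐ ω ∂P, 0 ≤ q.Gamma1 d (k + 1) ω := by
  filter_upwards [hq.ae_Zcheck_nonneg k, hq.X_nonneg (k + 1)] with ω hz hx
  exact le_min (le_max_left _ _) (add_nonneg hx hz)

theorem integrable_Gamma1 (hq : q.IsGIGI11 P) (d : ℝ) (k : ℕ) :
    Integrable (q.Gamma1 d (k + 1)) P := by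
  refine ((hq.integrable_X (k + 1)).add (hq.integrable_Zcheck k)).mono'
    (hq.measurable_Gamma1 d _).aestronglyMeasurable ?_
  filter_upwards [hq.ae_Gamma1_nonneg d k] with ω h
  rw [Real.norm_of_nonneg h]
  exact min_le_right _ _

theorem integral_gammaStar_le (hq : q.IsGIGI11 P) (d : ℝ) (k : ℕ) :
    ∫ ω, q.gammaStar d (k + 1) ω ∂P ≤ ∫ ω, q.Gamma1 d (k + 1) ω ∂P := by
  refine integral_mono_ae (hq.integrable_gammaStar d k) (hq.integrable_Gamma1 d k) ?_
  filter_upwards [hq.ae_isRenewalSeq, hq.X_nonneg k] with ω hz hx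
  have h := idle_le_Zcheck hz hx
  exact min_le_min (max_le_max le_rfl (by rw [Nat.add_sub_cancel]; linarith)) (by linarith)

end Integrability

end IsGIGI11

end GG11

section Occupation

theorem intervalIntegrable_indicator_one {s : Set ℝ} (hs : MeasurableSet s) (a b : ℝ) :
    IntervalIntegrable (s.indicator (1 : ℝ → ℝ)) volume a b :=
  intervalIntegrable_const.mono_fun ((measurable_one.indicator hs).aestronglyMeasurable)
    (ae_of_all _ fun t => norm_indicator_le_norm_self _ t)

theorem intervalIntegral_indicator_Ioi_one {a b : ℝ} (hab : a ≤ b) (c : ℝ) :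
    ∫ t in a..b, (Set.Ioi c).indicator (1 : ℝ → ℝ) t = min (max 0 (b - c)) (b - a) := by
  rw [intervalIntegral.integral_of_le hab, integral_indicator_one measurableSet_Ioi,
    measureReal_restrict_apply measurableSet_Ioi, Set.inter_comm, Set.Ioc_inter_Ioi, Measure.real,
    Real.volume_Ioc, ENNReal.toReal_ofReal']
  grind

theorem tendsto_inv_smul_intervalIntegral_indicator {s : Set ℝ} (hs : MeasurableSet s)
    {τ γ : ℕ → ℝ} (hγ : ∀ n, ∫ t in τ n..τ (n + 1), s.indicator (1 : ℝ → ℝ) t = γ n) {c x : ℝ}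
    (hc : 0 < c) (hτ : Tendsto (fun n : ℕ => τ n / n) atTop (𝓝 c))
    (hx : Tendsto (fun n : ℕ => (n : ℝ)⁻¹ • ∑ j ∈ Finset.range n, γ j) atTop (𝓝 x)) :
    Tendsto (fun T : ℝ => T⁻¹ • ∫ t in (0 : ℝ)..T, s.indicator (1 : ℝ → ℝ) t) atTop
      (𝓝 (c⁻¹ • x)) := by
  have hlip : LipschitzWith 1 fun b => ∫ t in (0 : ℝ)..b, s.indicator (1 : ℝ → ℝ) t :=
    lipschitzWith_intervalIntegral (measurable_one.indicator hs).aestronglyMeasurable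
      (fun t => (norm_indicator_le_norm_self _ t).trans_eq norm_one) 0
  refine tendsto_inv_smul_of_lipschitzWith hlip hc hτ ?_
  have hsplit : ∀ n, ∫ t in (0 : ℝ)..τ n, s.indicator (1 : ℝ → ℝ) t =
      (∫ t in (0 : ℝ)..τ 0, s.indicator (1 : ℝ → ℝ) t) + ∑ j ∈ Finset.range n, γ j := fun n => by
    rw [← Finset.sum_congr rfl fun j _ => hγ j,
      intervalIntegral.sum_integral_adjacent_intervals fun j _ =>
        intervalIntegrable_indicator_one hs _ _,
      intervalIntegral.integral_add_adjacent_intervals (intervalIntegrable_indicator_one hs _ _)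
        (intervalIntegrable_indicator_one hs _ _)]
  have hstart := (tendsto_inv_atTop_nhds_zero_nat (𝕜 := ℝ)).smul_const
    (∫ t in (0 : ℝ)..τ 0, s.indicator (1 : ℝ → ℝ) t)
  have hsum := hstart.add hx
  rw [zero_smul, zero_add] at hsum
  exact hsum.congr fun n => by rw [hsplit n, smul_add]

end Occupation

section MeasureReal

variable {Ω : Type*} [MeasurableSpace Ω] {P : Measure Ω}

theorem abs_measureReal_sub_le_of_ae_iff [IsFiniteMeasure P] {A B C : Set Ω}
    (h : ∀ᵐ ω ∂P, ω ∉ C → (ω ∈ A ↔ ω ∈ B)) : |P.real A - P.real B| ≤ P.real C := by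
  have hle : ∀ {A B : Set Ω}, (∀ᵐ ω ∂P, ω ∉ C → (ω ∈ A ↔ ω ∈ B)) →
      P.real A ≤ P.real B + P.real C := fun {A B} h => by
    refine le_trans (ENNReal.toReal_mono (by finiteness) (measure_mono_ae ?_))
      (measureReal_union_le B C)
    filter_upwards [h] with ω hω hA
    exact or_iff_not_imp_right.2 fun hC => (hω hC).1 hA
  rw [abs_sub_le_iff, sub_le_iff_le_add', sub_le_iff_le_add']
  exact ⟨hle h, hle (h.mono fun ω hω hC => (hω hC).symm)⟩

theorem intervalIntegral_measureReal [IsFiniteMeasure P] {V : Ω → Set ℝ}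
    (hV : MeasurableSet {p : ℝ × Ω | p.1 ∈ V p.2}) (a b : ℝ) :
    ∫ t in a..b, P.real {ω | t ∈ V ω} = ∫ ω, (∫ t in a..b, (V ω).indicator (1 : ℝ → ℝ) t) ∂P := by
  have hmeas : Measurable fun p : ℝ × Ω => (V p.2).indicator (1 : ℝ → ℝ) p.1 :=
    measurable_one.indicator hV
  have : IsFiniteMeasure (volume.restrict (Set.uIoc a b)) := by
    rw [Set.uIoc]
    infer_instance
  rw [← intervalIntegral_integral_swap (f := fun t ω => (V ω).indicator (1 : ℝ → ℝ) t)
    (Integrable.of_bound hmeas.aestronglyMeasurable 1 (ae_of_all _ fun p =>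
      (norm_indicator_le_norm_self _ p.1).trans_eq norm_one))]
  refine intervalIntegral.integral_congr fun t _ => ?_
  exact (integral_indicator_one (hV.preimage measurable_prodMk_left)).symm

variable [IsProbabilityMeasure P]

theorem tendsto_measureReal_lt_atTop {f : Ω → ℝ} (hf : Measurable f) :
    Tendsto (fun t => P.real {ω | t < f ω}) atTop (𝓝 0) := by
  have := Measure.isProbabilityMeasure_map (μ := P) hf.aemeasurable
  have hcdf : ∀ t, P.real {ω | t < f ω} = 1 - cdf (P.map f) t := fun t => by
    rw [cdf_eq_real, map_measureReal_apply hf measurableSet_Iic,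
      ← probReal_compl_eq_one_sub (hf measurableSet_Iic)]
    exact congrArg P.real (Set.ext fun ω => (not_le (a := f ω) (b := t)).symm)
  simpa only [hcdf, sub_self] using (tendsto_cdf_atTop (P.map f)).const_sub 1

theorem tendsto_inv_smul_intervalIntegral_measureReal {V : Ω → Set ℝ}
    (hV : MeasurableSet {p : ℝ × Ω | p.1 ∈ V p.2}) {c : ℝ}
    (h : ∀ᵐ ω ∂P, Tendsto (fun T : ℝ => T⁻¹ • ∫ t in (0 : ℝ)..T, (V ω).indicator (1 : ℝ → ℝ) t)
      atTop (𝓝 c)) :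
    Tendsto (fun T : ℝ => T⁻¹ • ∫ t in (0 : ℝ)..T, P.real {ω | t ∈ V ω}) atTop (𝓝 c) := by
  have hmeas : Measurable fun p : ℝ × Ω => (V p.2).indicator (1 : ℝ → ℝ) p.1 :=
    measurable_one.indicator hV
  have hmean := tendsto_integral_filter_of_dominated_convergence (fun _ => (1 : ℝ)) ?_ ?_
    (integrable_const 1) h
  · simpa only [intervalIntegral_measureReal hV, integral_smul, integral_const, probReal_univ,
      one_smul] using hmean
  · filter_upwards [eventually_ge_atTop 0] with T hT
    simp only [intervalIntegral.integral_of_le hT]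
    exact (hmeas.stronglyMeasurable.integral_prod_left').aestronglyMeasurable.const_smul T⁻¹
  · filter_upwards [eventually_gt_atTop 0] with T hT
    refine ae_of_all _ fun ω => ?_
    have hbound := intervalIntegral.norm_integral_le_of_norm_le_const (C := 1) (a := 0) (b := T)
      fun t _ => (norm_indicator_le_norm_self (1 : ℝ → ℝ) (s := V ω) t).trans_eq norm_one
    rw [one_mul, sub_zero, abs_of_pos hT] at hbound
    rw [norm_smul, norm_inv, Real.norm_of_nonneg hT.le, inv_mul_le_iff₀ hT, mul_one]
    exact hbound

end MeasureReal

theorem IsStationaryProcess.measureReal_lt_eq {Ω : Type*} [MeasurableSpace Ω] {P : Measure Ω}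
    {Y : ℝ → Ω → ℝ} (hY : IsStationaryProcess P Y) (d : ℝ) {t : ℝ} (ht : 0 ≤ t) :
    P.real {ω | d < Y t ω} = P.real {ω | d < Y 0 ω} := by
  have hident := (hY 1 (fun _ => 0) (fun _ => le_rfl) t ht).measure_mem_eq
    (s := {y | d < y 0}) (measurableSet_lt measurable_const (measurable_pi_apply 0))
  rw [zero_add] at hident
  exact congrArg ENNReal.toReal hident

namespace GG11

variable {Ω : Type*}

/-- The times after the first departure at which, along the path `ω`, the time elapsed since the
arrival of the last departed packet exceeds `d`. From `TD 0` on these are the times at which the age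
exceeds `d`; unlike the latter, this set is jointly measurable in the time and `ω`. -/
def violationTimes (q : GG11 Ω) (d : ℝ) (ω : Ω) : Set ℝ :=
  {t | ∃ k, q.TD k ω ≤ t ∧ t < q.TD (k + 1) ω ∧ d < t - q.TA k ω}

variable {q : GG11 Ω} {ω : Ω}

theorem mem_violationTimes_iff (hTD : Monotone fun k => q.TD k ω) {d t : ℝ} {k : ℕ}
    (hle : q.TD k ω ≤ t) (hlt : t < q.TD (k + 1) ω) :
    t ∈ q.violationTimes d ω ↔ d < t - q.TA k ω := by
  refine ⟨?_, fun h => ⟨k, hle, hlt, h⟩⟩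
  rintro ⟨j, hle', hlt', h⟩
  have hkj : k < j + 1 := hTD.reflect_lt (hle.trans_lt hlt')
  have hjk : j < k + 1 := hTD.reflect_lt (hle'.trans_lt hlt)
  rwa [show k = j by omega]

theorem exists_TD_le_lt {t : ℝ} (h0 : q.TD 0 ω ≤ t) (h : ∃ j, t < q.TD j ω) :
    ∃ k, q.TD k ω ≤ t ∧ t < q.TD (k + 1) ω := by
  by_contra! hstep
  obtain ⟨j, hj⟩ := h
  exact hj.not_ge (Nat.rec h0 hstep j)

theorem integral_violationTimes (hz : IsRenewalSeq fun n => q.Z n ω) (hx : ∀ k, 0 ≤ q.X k ω)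
    (d : ℝ) (k : ℕ) :
    ∫ t in q.TD k ω..q.TD (k + 1) ω, (q.violationTimes d ω).indicator (1 : ℝ → ℝ) t =
      q.gammaStar d (k + 1) ω := by
  have hTD := monotone_TD hz hx
  have hcongr : ∀ t ∈ Set.uIoo (q.TD k ω) (q.TD (k + 1) ω),
      (q.violationTimes d ω).indicator (1 : ℝ → ℝ) t =
        (Set.Ioi (d + q.TA k ω)).indicator (1 : ℝ → ℝ) t := fun t ht => by
    rw [Set.uIoo_of_le (hTD k.le_succ)] at ht
    refine Set.indicator_eq_indicator ?_ rfl
    rw [mem_violationTimes_iff hTD ht.1.le ht.2, Set.mem_Ioi, lt_sub_iff_add_lt]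
  rw [intervalIntegral.integral_congr_uIoo hcongr,
    intervalIntegral_indicator_Ioi_one (monotone_TD hz hx k.le_succ)]
  simp only [Nat.succ_eq_add_one, TD_succ]
  rw [TD, gammaStar, Nat.add_sub_cancel]
  congr 2 <;> ring

namespace IsGIGI11

variable [MeasurableSpace Ω] {P : Measure Ω}

theorem measurableSet_violationTimes (hq : q.IsGIGI11 P) (d : ℝ) :
    MeasurableSet {p : ℝ × Ω | p.1 ∈ q.violationTimes d p.2} := by
  have hTD : ∀ k, Measurable fun p : ℝ × Ω => q.TD k p.2 :=
    fun k => (hq.measurable_TD k).comp measurable_snd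
  have hTA : ∀ k, Measurable fun p : ℝ × Ω => q.TA k p.2 :=
    fun k => (hq.measurable_TA k).comp measurable_snd
  have hunion : {p : ℝ × Ω | p.1 ∈ q.violationTimes d p.2} =
      ⋃ k, {p | q.TD k p.2 ≤ p.1 ∧ p.1 < q.TD (k + 1) p.2 ∧ d < p.1 - q.TA k p.2} := by
    ext p
    rw [Set.mem_iUnion]
    rfl
  rw [hunion]
  exact MeasurableSet.iUnion fun k => (measurableSet_le (hTD k) measurable_fst).inter
    ((measurableSet_lt measurable_fst (hTD (k + 1))).inter
      (measurableSet_lt measurable_const (measurable_fst.sub (hTA k))))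

theorem ae_X_nonneg (hq : q.IsGIGI11 P) : ∀ᵐ ω ∂P, ∀ k, 0 ≤ q.X k ω :=
  ae_all_iff.2 hq.X_nonneg

variable [IsProbabilityMeasure P]

theorem ae_tendsto_TD_div (hq : q.IsGIGI11 P) (k : ℕ) :
    ∀ᵐ ω ∂P, Tendsto (fun n : ℕ => q.TD n ω / n) atTop
      (𝓝 (∫ ω, q.X (k + 1) ω ∂P + ∫ ω, q.idle (k + 1) ω ∂P)) := by
  have hslln := hq.ae_tendsto_average (g := fun p => p.2.1 + p.1.2) (by fun_prop) k
    ((hq.integrable_X (k + 1)).add (hq.integrable_idle k))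
  rw [← integral_add (hq.integrable_X (k + 1)) (hq.integrable_idle k)]
  filter_upwards [hslln] with ω hlim
  have hTD : ∀ n, q.TD n ω = q.TD 0 ω + ∑ j ∈ Finset.range n, (q.X (j + 1) ω + q.idle (j + 1) ω) :=
    fun n => by
      rw [← sub_eq_iff_eq_add', ← Finset.sum_range_sub (fun j => q.TD j ω)]
      exact Finset.sum_congr rfl fun j _ => sub_eq_iff_eq_add'.2 (TD_succ j)
  have hsum := (tendsto_const_div_atTop_nhds_zero_nat (q.TD 0 ω)).add hlim
  rw [zero_add] at hsum
  refine hsum.congr fun n => ?_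
  rw [hTD n, add_div, smul_eq_mul, ← div_eq_inv_mul]
  rfl

theorem ae_exists_lt_TD (hq : q.IsGIGI11 P) : ∀ᵐ ω ∂P, ∀ t, ∃ j, t < q.TD j ω := by
  filter_upwards [hq.ae_tendsto_TD_div 0] with ω h t
  have hTD := h.pos_mul_atTop (hq.integral_X_add_integral_idle_pos 0)
    (tendsto_natCast_atTop_atTop (R := ℝ))
  obtain ⟨n, hn, hn0⟩ := ((hTD.eventually_gt_atTop t).and (eventually_ne_atTop 0)).exists
  exact ⟨n, by rwa [div_mul_cancel₀ _ (Nat.cast_ne_zero.2 hn0)] at hn⟩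

theorem ae_tendsto_inv_smul_integral_violationTimes (hq : q.IsGIGI11 P) (d : ℝ) (k : ℕ) :
    ∀ᵐ ω ∂P, Tendsto
      (fun T : ℝ => T⁻¹ • ∫ t in (0 : ℝ)..T, (q.violationTimes d ω).indicator (1 : ℝ → ℝ) t) atTop
      (𝓝 (q.nu P (k + 1) * ∫ ω, q.gammaStar d (k + 1) ω ∂P)) := by
  have hslln := hq.ae_tendsto_average
    (g := fun p => min (max 0 (p.2.1 + p.1.1 + p.1.2 - d)) (p.2.1 + p.1.2)) (by fun_prop) k
    (hq.integrable_gammaStar d k)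
  filter_upwards [hslln, hq.ae_tendsto_TD_div k, hq.ae_isRenewalSeq, hq.ae_X_nonneg]
    with ω hγ hTD hz hx
  rw [nu, one_div]
  exact tendsto_inv_smul_intervalIntegral_indicator
    ((hq.measurableSet_violationTimes d).preimage measurable_prodMk_right)
    (integral_violationTimes hz hx d) (hq.integral_X_add_integral_idle_pos k) hTD hγ

theorem ae_lt_aoi_iff_mem_violationTimes (hq : q.IsGIGI11 P) (d : ℝ) :
    ∀ᵐ ω ∂P, ∀ t, q.TD 0 ω ≤ t → (d < q.aoi t ω ↔ t ∈ q.violationTimes d ω) := by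
  filter_upwards [hq.ae_isRenewalSeq, hq.ae_X_nonneg, hq.init_order, hq.ae_exists_lt_TD]
    with ω hz hx ⟨hUA, hA0, _, hF0⟩ hex t ht
  obtain ⟨k, hle, hlt⟩ := exists_TD_le_lt ht (hex t)
  rw [mem_violationTimes_iff (monotone_TD hz hx) hle hlt,
    aoi_eq_sub_TA hz hx (hUA.trans (hA0.trans hF0)) (hA0.trans hF0) hle hlt]

theorem tendsto_measureReal_violationTimes (hq : q.IsGIGI11 P) {d p : ℝ}
    (hp : Tendsto (fun t => P.real {ω | d < q.aoi t ω}) atTop (𝓝 p)) :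
    Tendsto (fun t => P.real {ω | t ∈ q.violationTimes d ω}) atTop (𝓝 p) := by
  have hdiff : Tendsto (fun t => P.real {ω | t ∈ q.violationTimes d ω} - P.real {ω | d < q.aoi t ω})
      atTop (𝓝 0) := by
    refine squeeze_zero_norm (fun t => ?_)
      (tendsto_measureReal_lt_atTop (P := P) (hq.measurable_TD 0))
    refine abs_measureReal_sub_le_of_ae_iff ?_
    filter_upwards [hq.ae_lt_aoi_iff_mem_violationTimes d] with ω h ht
    exact (h t (not_lt.1 ht)).symm
  simpa only [sub_add_cancel, zero_add] using hdiff.add hp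

theorem tendsto_inv_smul_integral_measureReal_violationTimes (hq : q.IsGIGI11 P) (d : ℝ) (k : ℕ) :
    Tendsto (fun T : ℝ => T⁻¹ • ∫ t in (0 : ℝ)..T, P.real {ω | t ∈ q.violationTimes d ω}) atTop
      (𝓝 (q.nu P (k + 1) * ∫ ω, q.gammaStar d (k + 1) ω ∂P)) :=
  tendsto_inv_smul_intervalIntegral_measureReal (hq.measurableSet_violationTimes d)
    (hq.ae_tendsto_inv_smul_integral_violationTimes d k)

theorem eq_of_tendsto_measureReal_lt_aoi (hq : q.IsGIGI11 P) {d p : ℝ} (k : ℕ)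
    (hp : Tendsto (fun t => P.real {ω | d < q.aoi t ω}) atTop (𝓝 p)) :
    p = q.nu P (k + 1) * ∫ ω, q.gammaStar d (k + 1) ω ∂P := by
  have hmeas : StronglyMeasurable fun t => P.real {ω | t ∈ q.violationTimes d ω} :=
    (measurable_measure_prodMk_left (hq.measurableSet_violationTimes d)).ennreal_toReal
      |>.stronglyMeasurable
  exact tendsto_nhds_unique
    (tendsto_inv_smul_intervalIntegral_of_tendsto hmeas (C := 1)
      (fun t => (Real.norm_of_nonneg measureReal_nonneg).trans_le measureReal_le_one)
      (hq.tendsto_measureReal_violationTimes hp))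
    (hq.tendsto_inv_smul_integral_measureReal_violationTimes d k)

end IsGIGI11

end GG11

theorem theorem7_general {Ω : Type*} [MeasurableSpace Ω] (P : Measure Ω) [IsProbabilityMeasure P]
    (q : GG11 Ω) (hq : q.IsGIGI11 P) (d : ℝ)
    (hlim : ∃ p, Tendsto (fun t : ℝ => P.real {ω | d < q.aoi t ω}) atTop (𝓝 p))
    (k : ℕ) (hk : 1 ≤ k) :
    Integrable (q.X k) P ∧ Integrable (q.idle k) P ∧
    0 < ∫ ω, q.X k ω ∂P + ∫ ω, q.idle k ω ∂P ∧
    Integrable (q.gammaStar d k) P ∧ Integrable (q.Gamma1 d k) P ∧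
    Tendsto (fun t : ℝ => P.real {ω | d < q.aoi t ω}) atTop
      (𝓝 (q.nu P k * ∫ ω, q.gammaStar d k ω ∂P)) ∧
    ∀ nuHat : ℝ, q.nu P k ≤ nuHat →
      q.nu P k * ∫ ω, q.gammaStar d k ω ∂P ≤ nuHat * ∫ ω, q.Gamma1 d k ω ∂P := by
  obtain ⟨k, rfl⟩ := Nat.exists_eq_add_of_le' hk
  obtain ⟨p, hp⟩ := hlim
  have hpos := hq.integral_X_add_integral_idle_pos k
  refine ⟨hq.integrable_X _, hq.integrable_idle k, hpos, hq.integrable_gammaStar d k,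
    hq.integrable_Gamma1 d k, hq.eq_of_tendsto_measureReal_lt_aoi k hp ▸ hp, fun nuHat hnu => ?_⟩
  exact (mul_le_mul_of_nonneg_left (hq.integral_gammaStar_le d k) (one_div_nonneg.2 hpos.le)).trans
    (mul_le_mul_of_nonneg_right hnu (integral_nonneg_of_ae (hq.ae_Gamma1_nonneg d k)))

theorem theorem7 {Ω : Type*} [MeasurableSpace Ω] (P : Measure Ω) [IsProbabilityMeasure P]
    (q : GG11 Ω) (hq : q.IsGIGI11 P) (hstat : IsStationaryProcess P q.aoi)
    (d : ℝ) (hd : 0 < d) (k : ℕ) (hk : 1 ≤ k) :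
    Integrable (q.X k) P ∧ Integrable (q.idle k) P ∧
    0 < ∫ ω, q.X k ω ∂P + ∫ ω, q.idle k ω ∂P ∧
    Integrable (q.gammaStar d k) P ∧ Integrable (q.Gamma1 d k) P ∧
    Tendsto (fun t : ℝ => P.real {ω | d < q.aoi t ω}) atTop
      (𝓝 (q.nu P k * ∫ ω, q.gammaStar d k ω ∂P)) ∧
    ∀ nuHat : ℝ, q.nu P k ≤ nuHat →
      q.nu P k * ∫ ω, q.gammaStar d k ω ∂P ≤ nuHat * ∫ ω, q.Gamma1 d k ω ∂P :=
  theorem7_general P q hq d ⟨_, tendsto_const_nhds.congr' ((eventually_ge_atTop 0).mono fun _ ht =>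
    (hstat.measureReal_lt_eq d ht).symm)⟩ k hk
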